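/- Let $(M_3,\omega_{(3)})$ be the Eierlegende Wollmilchsau: the translation surface obtained from eight unit squares $sq(g)$, indexed by the elements $g$ of the quaternion group $Q=\{\pm1,\pm i,\pm j,\pm k\}$, by gluing, by translations, the right-hand side of $sq(g)$ to the left-hand side of $sq(gi)$ and the top side of $sq(g)$ to the bottom side of $sq(gj)$. Let $\pi: M_3\to E=\mathbb{R}^2/\mathbb{Z}^2$ be the natural projection, of degree $8$, so that $\omega_{(3)}=\pi^*dz$; it has four zeros. Let $p:X\to M_3$ be a finite ramified covering with $X$ a compact connected surface, put $\omega=p^*\omega_{(3)}$ and $q=\pi\circ p:X\to E$. For a translation surface $(M,\eta)$ let $\mathrm{Aff}(M,\eta)$ be the group of affine diffeomorphisms, i.e. of the orientation-preserving homeomorphisms of $M$ that preserve the set of zeros of $\eta$ and whose local expressions in translation charts are affine maps of the plane, and let $D(f)$ denote the linear part of $f\in\mathrm{Aff}(M,\eta)$. Let $\Gamma(4)\subset SL(2,\mathbb{Z})$ be the principal congruence subgroup of level $4$, let $\mathrm{Aff}_{(1)}(M_3,\omega_{(3)})$ be the subgroup of those elements of $\mathrm{Aff}(M_3,\omega_{(3)})$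 that fix each zero of $\omega_{(3)}$, and let $\Gamma_{EW}(4)$ be the subgroup of those $g\in \mathrm{Aff}_{(1)}(M_3,\omega_{(3)})$ with $D(g)\in\Gamma(4)$. The ramification data of a ramified covering at a point of its target is the list (up to order) of the ramification indices of all preimages of that point. Consider the following conditions. A) $q$ is ramified at most over $4$-division points of $E$, i.e. over points $P$ with $4P=0$. B) $q$ is ramified over $(0,0)$, $(3/4,0)$ and $(0,1/4)$, and the ramification data of $q$ at these three points are pairwise distinct and different from the ramification data of $q$ at all other points of $E$. C) The ramification data of $p$ at the four zeros of $\omega_{(3)}$ are pairwise distinct. Then: i) If A) and B) hold, then every $f\in\mathrm{Aff}(X,\omega)$ descends via $p$ to some $g\in\mathrm{Aff}(M_3,\omega_{(3)})$, i.e. $g\circ p=p\circ f$, and $D(f)=D(g)$ lies in $\Gamma(4)$. ii) If in addition C) holds, then $g$ fixes each of the four zeros of $\omega_{(3)}$, i.e. $g\in\mathrm{Aff}_{(1)}(M_3,\omega_{(3)})$; in particular $g\in\Gamma_{EW}(4)$. -/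

import Mathlib

/-! ### Ramified coverings of surfaces -/

/-- In suitable local coordinates centred at `x` and at `p x`, the map `p` is `z ↦ z ^ n`,
with `n ≥ 1`. -/
def HasLocalForm {X Y : Type*} [TopologicalSpace X] [TopologicalSpace Y]
    (p : X → Y) (x : X) (n : ℕ) : Prop :=
  0 < n ∧ ∃ (φ : OpenPartialHomeomorph X ℂ) (ψ : OpenPartialHomeomorph Y ℂ),
    x ∈ φ.source ∧ p x ∈ ψ.source ∧ φ x = 0 ∧ ψ (p x) = 0 ∧
      ∀ y ∈ φ.source, p y ∈ ψ.source ∧ ψ (p y) = φ y ^ n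

/-- `p` is a ramified (branched) covering: it is continuous and has a local form `z ↦ z ^ n`
at every point. (For a compact source all fibres are then finite.) -/
def IsRamifiedCovering {X Y : Type*} [TopologicalSpace X] [TopologicalSpace Y]
    (p : X → Y) : Prop :=
  Continuous p ∧ ∀ x : X, ∃ n : ℕ, HasLocalForm p x n

/-- The ramification index of `p` at `x`: the exponent `n` of the local form `z ↦ z ^ n`.
(There is only one such exponent, as it is the number of preimages near `x` of any point that is
close to, and different from, `p x`.) -/
noncomputable def ramificationIndex {X Y : Type*} [TopologicalSpace X] [TopologicalSpace Y]
    (p : X → Y) (x : X) : ℕ :=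
  sInf {n : ℕ | HasLocalForm p x n}

/-- `x` is a ramification point of `p`. -/
def IsRamifiedAt {X Y : Type*} [TopologicalSpace X] [TopologicalSpace Y]
    (p : X → Y) (x : X) : Prop :=
  ramificationIndex p x ≠ 1

/-- `p` is ramified over `y`. -/
def IsRamifiedOver {X Y : Type*} [TopologicalSpace X] [TopologicalSpace Y]
    (p : X → Y) (y : Y) : Prop :=
  ∃ x : X, p x = y ∧ IsRamifiedAt p x

/-- The ramification data of `p` at `y`: the list, up to order, of the ramification indices of
all preimages of `y`, recorded through the number of times that each `n` occurs in it. -/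
noncomputable def ramificationData {X Y : Type*} [TopologicalSpace X] [TopologicalSpace Y]
    (p : X → Y) (y : Y) : ℕ → ℕ∞ :=
  fun n => {x : X | p x = y ∧ ramificationIndex p x = n}.encard

/-! ### The torus and translation surfaces covering it -/

/-- The torus `E = ℝ² / ℤ²`. -/
abbrev Torus : Type := UnitAddTorus (Fin 2)

/-- The quotient map `ℝ² → ℝ² / ℤ²`. -/
def toTorus (v : Fin 2 → ℝ) : Torus := fun i => (v i : UnitAddCircle)

/-- `P` is a `4`-division point of the torus. -/
def IsFourDivisionPoint (P : Torus) : Prop := 4 • P = 0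

/-- A ramified covering `q : X → E` of the torus makes `X` a translation surface with the
differential `ω = q^* dz`. A primitive of `ω` is locally the same as a lift of `q` to the plane
(up to an additive constant), so these charts form a translation atlas off the zeros of `ω`. -/
def IsTranslationChart {X : Type*} [TopologicalSpace X] (q : X → Torus)
    (φ : OpenPartialHomeomorph X (Fin 2 → ℝ)) : Prop :=
  ∀ x ∈ φ.source, toTorus (φ x) = q x

/-- The set `Σ` of zeros of `ω = q^* dz`: the order of vanishing of `ω` at a point is the
ramification index of `q` minus one. -/
def zeros {X : Type*} [TopologicalSpace X] (q : X → Torus) : Set X :=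
  {x | IsRamifiedAt q x}

/-- The group (as a set) `Aff(X, ω)`, with `ω = q^* dz`, of affine diffeomorphisms:
the homeomorphisms of `X` that preserve the set of zeros of `ω` and whose local expressions in
translation charts are orientation-preserving affine maps of the plane. -/
def Aff {X : Type*} [TopologicalSpace X] (q : X → Torus) : Set (X ≃ₜ X) :=
  {f | f '' zeros q = zeros q ∧
    ∀ φ ψ : OpenPartialHomeomorph X (Fin 2 → ℝ),
      IsTranslationChart q φ → IsTranslationChart q ψ →
      ∀ x ∈ φ.source, f x ∈ ψ.source →
        ∃ (A : Matrix (Fin 2) (Fin 2) ℝ) (b : Fin 2 → ℝ), 0 < A.det ∧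
          ∀ᶠ y in nhds x, ψ (f y) = A.mulVec (φ y) + b}

/-- `D(f) = A`: in translation charts, all local expressions of `f` have linear part `A`. -/
def HasLinearPart {X : Type*} [TopologicalSpace X] (q : X → Torus) (f : X ≃ₜ X)
    (A : Matrix (Fin 2) (Fin 2) ℝ) : Prop :=
  ∀ φ ψ : OpenPartialHomeomorph X (Fin 2 → ℝ),
    IsTranslationChart q φ → IsTranslationChart q ψ →
    ∀ x ∈ φ.source, f x ∈ ψ.source →
      ∃ b : Fin 2 → ℝ, ∀ᶠ y in nhds x, ψ (f y) = A.mulVec (φ y) + b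

/-! ### The Eierlegende Wollmilchsau -/

/-- The quaternion group of order `8`; in Mathlib's notation `i = a 1`, `j = xa 0`, `-1 = a 2`
and `k = i * j = xa 3`. -/
abbrev Q8 : Type := QuaternionGroup 2

/-- The disjoint union of the eight closed unit squares `sq(g)`, for `g` in the quaternion
group. -/
abbrev EWSquares : Type := Σ _ : Q8, unitInterval × unitInterval

/-- The gluing rule: the right-hand side of `sq(g)` is glued by translation to the left-hand side
of `sq(g i)`, the top side of `sq(g)` is glued by translation to the bottom side of `sq(g j)`. -/
inductive EWGlue : EWSquares → EWSquares → Prop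
  | right (g : Q8) (t : unitInterval) :
      EWGlue ⟨g, (1, t)⟩ ⟨g * QuaternionGroup.a 1, (0, t)⟩
  | top (g : Q8) (s : unitInterval) :
      EWGlue ⟨g, (s, 1)⟩ ⟨g * QuaternionGroup.xa 0, (s, 0)⟩

/-- The Eierlegende Wollmilchsau `M₃`: the quotient of the eight squares by the equivalence
relation that the gluing rule generates. -/
def EW : Type := Quot EWGlue

instance : TopologicalSpace EW := inferInstanceAs (TopologicalSpace (Quot EWGlue))

/-- The natural projection `π : M₃ → ℝ² / ℤ²`, of degree `8`. The differential of `M₃` is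
`π^* dz`. -/
def ewProj : EW → Torus :=
  Quot.lift (fun z : EWSquares => toTorus ![(z.2.1 : ℝ), (z.2.2 : ℝ)]) (by
    have h1 : ((1 : ℝ) : UnitAddCircle) = 0 := AddCircle.coe_period 1
    rintro _ _ (⟨g, t⟩ | ⟨g, s⟩) <;>
      · funext k
        fin_cases k <;> simp [toTorus, h1])

/-- `Aff_(1)(M₃)`: the affine diffeomorphisms of `M₃` that fix each zero of its differential. -/
def AffFixingZeros : Set (EW ≃ₜ EW) :=
  {g | g ∈ Aff ewProj ∧ ∀ z ∈ zeros ewProj, g z = z}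

/-- `Γ_EW(4)`: the elements of `Aff_(1)(M₃)` with derivative in the principal congruence subgroup
`Γ(4)` of `SL(2, ℤ)`. -/
def GammaEW4 : Set (EW ≃ₜ EW) :=
  {g | g ∈ AffFixingZeros ∧ ∃ γ ∈ CongruenceSubgroup.Gamma 4,
    HasLinearPart ewProj g (γ.1.map (Int.cast : ℤ → ℝ))}

/-! ### The conditions on the covering -/

/-- The three marked points `(0,0)`, `(3/4,0)`, `(0,1/4)` of the torus. -/
noncomputable def markedPoints : Set Torus :=
  {toTorus ![0, 0], toTorus ![3 / 4, 0], toTorus ![0, 1 / 4]}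

/-- Condition A: `q` is ramified at most over `4`-division points. -/
def ConditionA {X : Type*} [TopologicalSpace X] (q : X → Torus) : Prop :=
  ∀ P : Torus, IsRamifiedOver q P → IsFourDivisionPoint P

/-- Condition B: `q` is ramified over the three marked points, and its ramification data at each
of them is different from that at every other point of the torus (in particular, the three are
pairwise different). -/
def ConditionB {X : Type*} [TopologicalSpace X] (q : X → Torus) : Prop :=
  ∀ P ∈ markedPoints, IsRamifiedOver q P ∧
    ∀ P' : Torus, P' ≠ P → ramificationData q P' ≠ ramificationData q P

/-- Condition C: the ramification data of `p` at the zeros of the differential of `M₃` are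
pairwise distinct. -/
def ConditionC {X : Type*} [TopologicalSpace X] (p : X → EW) : Prop :=
  ∀ z ∈ zeros ewProj, ∀ z' ∈ zeros ewProj, z ≠ z' →
    ramificationData p z ≠ ramificationData p z'

open Filter Topology

/-! ### The torus and small lifts to the plane -/

/-! Write `q` for `ewProj ∘ p`. Off its zeros, `q ∘ f` is locally an affine function of `q`. The
zeros are finite in number and removing them does not disconnect `X`, so the linear part `A` is
globally constant, and by continuity the affine relation also holds at the zeros
(`exists_forall_isAffineAt`).

Integrality of `A` comes from comparing zeros. A clopen argument in the plane (`exists_point_over`),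
playing the role of path lifting, starts from a zero over `(3/4, 0)` or `(0, 1/4)` and produces a
point over the origin whose `q ∘ f`-value differs by `A` times the displacement. That point is also
a zero, because `ewProj` is itself branched over the origin. Since `f` permutes zeros and zeros lie
over 4-division points, `A` times a quarter of a basis vector lies in `(1/4)ℤ²`, so `A` is integral.
The same applied to `f.symm` puts `A` in `SL(2, ℤ)`, so `f` covers an affine map `P ↦ γ P + c` of
the torus. Such a map preserves ramification data (`ramificationData_comm`), so condition B makes it
fix the three marked points. This gives `c = 0` and `γ ∈ Γ(4)`.

Every `γ` lifts to `M₃` (`exists_isLiftOf`), since the generators `S` and `T` do so through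
automorphisms of the quaternion group. If `g₀` is a lift, then `g₀ ∘ p` and `p ∘ f` lie over the
same map to the torus. The deck group, the quaternion group acting by left multiplication, is
transitive on fibres and free off the vertices, so one deck transformation carries the first map to
the second (`exists_deck_comp_eq`). Composing it with `g₀` gives `g`. Finally `g` permutes the zeros
and preserves the ramification data of `p`, so condition C makes it fix each zero.

Surface charts on `M₃` are not constructed: it suffices that `M₃` is Hausdorff and connected and
that `ewProj` is open with finite fibres. -/

theorem toTorus_add (v w : Fin 2 → ℝ) : toTorus (v + w) = toTorus v + toTorus w := rfl

theorem toTorus_sub (v w : Fin 2 → ℝ) : toTorus (v - w) = toTorus v - toTorus w := rfl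

theorem toTorus_zero : toTorus 0 = 0 := rfl

theorem continuous_toTorus : Continuous toTorus :=
  continuous_pi fun i => (AddCircle.continuous_mk' 1).comp (continuous_apply i)

theorem toTorus_eq_zero_iff {v : Fin 2 → ℝ} : toTorus v = 0 ↔ ∀ i, ∃ n : ℤ, v i = n := by
  simp only [funext_iff, toTorus, Pi.zero_apply, UnitAddCircle, AddCircle.coe_eq_zero_iff]
  simp [eq_comm]

theorem toTorus_eq_iff {v w : Fin 2 → ℝ} :
    toTorus v = toTorus w ↔ ∀ i, ∃ n : ℤ, v i - w i = n := by
  rw [← sub_eq_zero, ← toTorus_sub, toTorus_eq_zero_iff]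
  rfl

/-- The lift to the plane of a point of the torus with coordinates in `[-1/2, 1/2)`. -/
noncomputable def smallLift (P : Torus) : Fin 2 → ℝ :=
  fun i => AddCircle.equivIco 1 (-1 / 2) (P i)

theorem toTorus_smallLift (P : Torus) : toTorus (smallLift P) = P :=
  funext fun _ => AddCircle.coe_equivIco

theorem smallLift_toTorus {v : Fin 2 → ℝ} (hv : ∀ i, |v i| < 1 / 2) :
    smallLift (toTorus v) = v := by
  funext i
  have h := abs_lt.1 (hv i)
  exact AddCircle.equivIco_coe_of_mem ⟨by linarith [h.1], by linarith [h.2]⟩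

theorem smallLift_zero : smallLift 0 = 0 := by
  rw [← toTorus_zero]
  exact smallLift_toTorus (by simp)

/-- The lift jumps only where a coordinate is the class of `-1/2`, and that class is not zero. -/
theorem continuousAt_smallLift_zero : ContinuousAt smallLift 0 := by
  refine continuousAt_pi.2 fun i => ?_
  have h : ContinuousAt (fun x : UnitAddCircle => (AddCircle.equivIco (1 : ℝ) (-1 / 2) x : ℝ))
      ((0 : Torus) i) := by
    refine continuous_subtype_val.continuousAt.comp (AddCircle.continuousAt_equivIco _ _ ?_)
    intro h
    have h' : (((0 : ℝ) - (-1 / 2) : ℝ) : UnitAddCircle) = 0 := by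
      rw [AddCircle.coe_sub, ← h]; simp
    obtain ⟨n, hn⟩ := (AddCircle.coe_eq_zero_iff _).1 h'
    have : ((2 * n : ℤ) : ℝ) = (1 : ℤ) := by push_cast; simp at hn; linarith
    have := Int.cast_injective this
    omega
  exact ContinuousAt.comp (f := fun P : Torus => P i) h (continuous_apply i).continuousAt

/-- The points of the torus whose small lift has coordinates of absolute value below `1/4`. -/
def IsSmall (P : Torus) : Prop := ∀ i, |smallLift P i| < 1 / 4

theorem eventually_isSmall : ∀ᶠ P in 𝓝 (0 : Torus), IsSmall P := by
  refine eventually_all.2 fun i => ?_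
  have h : Tendsto (fun P => |smallLift P i|) (𝓝 0) (𝓝 |smallLift 0 i|) :=
    ((continuous_apply i).continuousAt.comp continuousAt_smallLift_zero).abs
  rw [smallLift_zero] at h
  exact h.eventually (gt_mem_nhds (by simp))

/-- The bound `1/4` keeps the difference of the two lifts below `1/2`, the range where the lift is
determined by its class. -/
theorem smallLift_sub {P Q : Torus} (hP : IsSmall P) (hQ : IsSmall Q) :
    smallLift (P - Q) = smallLift P - smallLift Q := by
  conv_lhs => rw [← toTorus_smallLift P, ← toTorus_smallLift Q, ← toTorus_sub]
  refine smallLift_toTorus fun i => ?_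
  have h := abs_sub (smallLift P i) (smallLift Q i)
  have h1 := hP i
  have h2 := hQ i
  rw [Pi.sub_apply]
  linarith

theorem eventually_small_abs : ∀ᶠ v : Fin 2 → ℝ in 𝓝 0, ∀ i, |v i| < 1 / 2 := by
  refine eventually_all.2 fun i => ?_
  have h : Tendsto (fun v : Fin 2 → ℝ => |v i|) (𝓝 0) (𝓝 |(0 : Fin 2 → ℝ) i|) :=
    (continuous_apply i).abs.continuousAt
  exact h.eventually (gt_mem_nhds (by simp))

theorem eventually_smallLift_toTorus :
    ∀ᶠ v : Fin 2 → ℝ in 𝓝 0, smallLift (toTorus v) = v :=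
  eventually_small_abs.mono fun _ => smallLift_toTorus

theorem tendsto_smallLift_sub (P : Torus) :
    Tendsto (fun Q => smallLift (Q - P)) (𝓝 P) (𝓝 0) := by
  have h : Tendsto (fun Q : Torus => Q - P) (𝓝 P) (𝓝 0) := by
    simpa using (continuous_id.sub continuous_const).tendsto (x := P) (f := fun Q : Torus => Q - P)
  have h' := continuousAt_smallLift_zero.tendsto.comp h
  rwa [smallLift_zero] at h'

theorem finite_fourDivisionPoints : {P : Torus | IsFourDivisionPoint P}.Finite := by
  have h : {P : Torus | IsFourDivisionPoint P} =
      Set.univ.pi fun _ : Fin 2 => {u : UnitAddCircle | 4 • u = 0} := by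
    ext P
    simp only [IsFourDivisionPoint, Set.mem_ofPred_eq, Set.mem_pi, funext_iff, Pi.smul_apply,
      Pi.zero_apply, Set.mem_univ, forall_const]
  rw [h]
  exact Set.Finite.pi fun _ => AddCircle.finite_torsion (1 : ℝ) (by norm_num : 0 < 4)

/-- The endomorphism of the torus given by an integer matrix. -/
def torusEnd (γ : Matrix (Fin 2) (Fin 2) ℤ) (P : Torus) : Torus :=
  fun i => γ i 0 • P 0 + γ i 1 • P 1

theorem continuous_torusEnd (γ : Matrix (Fin 2) (Fin 2) ℤ) : Continuous (torusEnd γ) :=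
  continuous_pi fun _ => ((continuous_apply 0).zsmul _).add ((continuous_apply 1).zsmul _)

theorem torusEnd_toTorus (γ : Matrix (Fin 2) (Fin 2) ℤ) (v : Fin 2 → ℝ) :
    torusEnd γ (toTorus v) = toTorus ((γ.map (Int.cast : ℤ → ℝ)).mulVec v) := by
  funext i
  simp only [torusEnd, toTorus, Matrix.mulVec, dotProduct, Fin.sum_univ_two, Matrix.map_apply,
    AddCircle.coe_add, ← AddCircle.coe_zsmul, zsmul_eq_mul]

theorem torusEnd_add (γ : Matrix (Fin 2) (Fin 2) ℤ) (P Q : Torus) :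
    torusEnd γ (P + Q) = torusEnd γ P + torusEnd γ Q := by
  funext i
  simp only [torusEnd, Pi.add_apply, smul_add]
  abel

theorem torusEnd_sub (γ : Matrix (Fin 2) (Fin 2) ℤ) (P Q : Torus) :
    torusEnd γ (P - Q) = torusEnd γ P - torusEnd γ Q := by
  funext i
  simp only [torusEnd, Pi.sub_apply, smul_sub]
  abel

theorem torusEnd_zero (γ : Matrix (Fin 2) (Fin 2) ℤ) : torusEnd γ 0 = 0 := by
  funext i
  simp [torusEnd]

theorem torusEnd_mul (γ δ : Matrix (Fin 2) (Fin 2) ℤ) (P : Torus) :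
    torusEnd (γ * δ) P = torusEnd γ (torusEnd δ P) := by
  funext i
  simp only [torusEnd, Matrix.mul_apply, Fin.sum_univ_two, smul_add, smul_smul, add_smul]
  abel

theorem torusEnd_one (P : Torus) : torusEnd 1 P = P := by
  funext i
  fin_cases i
  · change (1 : ℤ) • P 0 + (0 : ℤ) • P 1 = P 0
    simp
  · change (0 : ℤ) • P 0 + (1 : ℤ) • P 1 = P 1
    simp

/-- A matrix is determined by the germ at `0` of the map that it induces to the torus. -/
theorem eq_of_eventually_toTorus_mulVec_eq {A B : Matrix (Fin 2) (Fin 2) ℝ}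
    (h : ∀ᶠ v : Fin 2 → ℝ in 𝓝 0, toTorus (A.mulVec v) = toTorus (B.mulVec v)) : A = B := by
  have hc : Tendsto (fun v : Fin 2 → ℝ => (A - B).mulVec v) (𝓝 0) (𝓝 0) := by
    have : Continuous fun v : Fin 2 → ℝ => (A - B).mulVec v :=
      Continuous.matrix_mulVec continuous_const continuous_id
    simpa using this.tendsto 0
  have h0 : ∀ᶠ v : Fin 2 → ℝ in 𝓝 0, (A - B).mulVec v = 0 := by
    filter_upwards [h, hc.eventually eventually_smallLift_toTorus] with v hv hv'
    rw [← hv', Matrix.sub_mulVec, toTorus_sub, hv, sub_self, smallLift_zero]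
  rw [← sub_eq_zero]
  ext i j
  -- A linear map that vanishes near `0` is tested on small nonzero multiples of a basis vector.
  have ht : Tendsto (fun r : ℝ => r • (Pi.single j 1 : Fin 2 → ℝ)) (𝓝[≠] 0) (𝓝 0) := by
    have : Continuous fun r : ℝ => r • (Pi.single j 1 : Fin 2 → ℝ) := by fun_prop
    simpa using (this.tendsto 0).mono_left nhdsWithin_le_nhds
  obtain ⟨r, hr, hr0⟩ := ((ht.eventually h0).and self_mem_nhdsWithin).exists
  have := congrFun hr i
  rw [Matrix.mulVec_smul, Matrix.mulVec_single_one] at this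
  simpa [show r ≠ 0 from hr0] using this

theorem continuous_toTorus_mulVec (A : Matrix (Fin 2) (Fin 2) ℝ) :
    Continuous fun v => toTorus (A.mulVec v) :=
  continuous_toTorus.comp (Continuous.matrix_mulVec continuous_const continuous_id)

/-- Around every point of the plane, the quotient map to the torus restricts to a
homeomorphism between open sets. -/
theorem exists_toTorus_chart (P : Torus) :
    ∃ τ : OpenPartialHomeomorph (Fin 2 → ℝ) Torus, P ∈ τ.target ∧ ∀ v, τ v = toTorus v := by
  -- The circle chart misses only the class of its left endpoint; centring the interval at the lift
  -- of `P` keeps `P` in the target.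
  refine ⟨OpenPartialHomeomorph.pi fun i => AddCircle.openPartialHomeomorphCoe (1 : ℝ)
    (smallLift P i - 1 / 2), ?_, fun v => rfl⟩
  intro i _
  simp only [AddCircle.openPartialHomeomorphCoe]
  intro h
  have h1 : ((smallLift P i : ℝ) : UnitAddCircle) = P i := congrFun (toTorus_smallLift P) i
  have h2 : P i = ((smallLift P i - 1 / 2 : ℝ) : UnitAddCircle) := h
  have h3 : (((1 / 2 : ℝ)) : UnitAddCircle) = 0 := by
    rw [AddCircle.coe_sub, h1] at h2
    exact sub_eq_self.1 h2.symm
  obtain ⟨n, hn⟩ := (AddCircle.coe_eq_zero_iff _).1 h3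
  have : ((2 * n : ℤ) : ℝ) = (1 : ℤ) := by push_cast; simp at hn; linarith
  have := Int.cast_injective this
  omega

/-! ### The Eierlegende Wollmilchsau: coordinates on the squares -/

/-- The point of `M₃` with coordinates `(s, t)`, clamped to the unit square, in `sq(g)`. -/
noncomputable def ewPt (g : Q8) (s t : ℝ) : EW :=
  Quot.mk _ ⟨g, (Set.projIcc 0 1 zero_le_one s, Set.projIcc 0 1 zero_le_one t)⟩

theorem continuous_ewPt (g : Q8) : Continuous fun v : ℝ × ℝ => ewPt g v.1 v.2 :=
  continuous_quot_mk.comp (continuous_sigmaMk.comp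
    ((continuous_projIcc.comp continuous_fst).prodMk (continuous_projIcc.comp continuous_snd)))

theorem Continuous.ewPt {Y : Type*} [TopologicalSpace Y] {s t : Y → ℝ} (g : Q8)
    (hs : Continuous s) (ht : Continuous t) : Continuous fun y => ewPt g (s y) (t y) :=
  (continuous_ewPt g).comp (hs.prodMk ht)

theorem mk_eq_ewPt (g : Q8) (z : unitInterval × unitInterval) :
    (Quot.mk _ ⟨g, z⟩ : EW) = ewPt g z.1 z.2 := by
  simp [ewPt, Set.projIcc_val]

theorem ewPt_one_left (g : Q8) (t : ℝ) : ewPt g 1 t = ewPt (g * QuaternionGroup.a 1) 0 t := by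
  simp only [ewPt, Set.projIcc_left, Set.projIcc_right]
  exact Quot.sound (EWGlue.right g _)

theorem ewPt_one_right (g : Q8) (s : ℝ) : ewPt g s 1 = ewPt (g * QuaternionGroup.xa 0) s 0 := by
  simp only [ewPt, Set.projIcc_left, Set.projIcc_right]
  exact Quot.sound (EWGlue.top g _)

theorem exists_eq_ewPt (x : EW) :
    ∃ g : Q8, ∃ s ∈ Set.Ico (0 : ℝ) 1, ∃ t ∈ Set.Ico (0 : ℝ) 1, x = ewPt g s t := by
  obtain ⟨⟨g, s, t⟩, rfl⟩ := Quot.exists_rep x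
  have key : ∃ g' : Q8, ∃ s' ∈ Set.Ico (0 : ℝ) 1, ewPt g s t = ewPt g' s' t := by
    rcases s.2.2.lt_or_eq with h | h
    · exact ⟨g, s, ⟨s.2.1, h⟩, rfl⟩
    · exact ⟨_, 0, by simp, by rw [h, ewPt_one_left]⟩
  obtain ⟨g', s', hs', h⟩ := key
  rw [mk_eq_ewPt, h]
  rcases t.2.2.lt_or_eq with h' | h'
  · exact ⟨g', s', hs', t, ⟨t.2.1, h'⟩, rfl⟩
  · exact ⟨_, s', hs', 0, by simp, by rw [h', ewPt_one_right]⟩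

theorem ewProj_ewPt (g : Q8) {s t : ℝ} (hs : s ∈ Set.Icc (0 : ℝ) 1) (ht : t ∈ Set.Icc (0 : ℝ) 1) :
    ewProj (ewPt g s t) = toTorus ![s, t] := by
  change toTorus ![((Set.projIcc 0 1 zero_le_one s : unitInterval) : ℝ), _] = _
  rw [Set.projIcc_of_mem _ hs, Set.projIcc_of_mem _ ht]

theorem continuous_ewProj : Continuous ewProj := by
  refine continuous_quot_lift _ (continuous_toTorus.comp (continuous_pi fun i => ?_))
  refine continuous_sigma fun g => ?_
  fin_cases i
  · exact continuous_subtype_val.comp continuous_fst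
  · exact continuous_subtype_val.comp continuous_snd

/-- A map out of `M₃` given by its restrictions to the squares. -/
def EW.desc {Y : Type*} (G : Q8 → ℝ → ℝ → Y)
    (h₁ : ∀ g, ∀ t ∈ Set.Icc (0 : ℝ) 1, G g 1 t = G (g * QuaternionGroup.a 1) 0 t)
    (h₂ : ∀ g, ∀ s ∈ Set.Icc (0 : ℝ) 1, G g s 1 = G (g * QuaternionGroup.xa 0) s 0) : EW → Y :=
  Quot.lift (fun z : EWSquares => G z.1 z.2.1 z.2.2) (by
    rintro _ _ (⟨g, t⟩ | ⟨g, s⟩)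
    · exact h₁ g t t.2
    · exact h₂ g s s.2)

theorem EW.desc_ewPt {Y : Type*} {G : Q8 → ℝ → ℝ → Y} {h₁ h₂} (g : Q8) {s t : ℝ}
    (hs : s ∈ Set.Icc (0 : ℝ) 1) (ht : t ∈ Set.Icc (0 : ℝ) 1) :
    EW.desc G h₁ h₂ (ewPt g s t) = G g s t := by
  change G g (Set.projIcc 0 1 zero_le_one s : unitInterval) _ = _
  rw [Set.projIcc_of_mem _ hs, Set.projIcc_of_mem _ ht]

theorem EW.continuous_desc {Y : Type*} [TopologicalSpace Y] {G : Q8 → ℝ → ℝ → Y} {h₁ h₂}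
    (hG : ∀ g, Continuous fun v : ℝ × ℝ => G g v.1 v.2) : Continuous (EW.desc G h₁ h₂) := by
  refine continuous_quot_lift _ (continuous_sigma fun g => ?_)
  exact (hG g).comp ((continuous_subtype_val.comp continuous_fst).prodMk
    (continuous_subtype_val.comp continuous_snd))

/-! ### Separation of points -/

/-- The indicator function of the class of `g` in the quotient of the quaternion group by its
centre. -/
def classIndicator (g h : Q8) : ℝ := if h = g ∨ h = g * QuaternionGroup.a 2 then 1 else 0

/-- `ij` and `ji` differ by the central element `-1`. This is what makes `vertexFun` compatible with
the gluing. -/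
theorem classIndicator_comm (g : Q8) :
    classIndicator (g * QuaternionGroup.a 1 * QuaternionGroup.xa 0) =
      classIndicator (g * QuaternionGroup.xa 0 * QuaternionGroup.a 1) := by
  have h : ∀ g h : Q8, (h = g * QuaternionGroup.a 1 * QuaternionGroup.xa 0 ∨
      h = g * QuaternionGroup.a 1 * QuaternionGroup.xa 0 * QuaternionGroup.a 2) ↔
      (h = g * QuaternionGroup.xa 0 * QuaternionGroup.a 1 ∨
      h = g * QuaternionGroup.xa 0 * QuaternionGroup.a 1 * QuaternionGroup.a 2) := by decide
  funext k
  simp only [classIndicator, h g k]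

/-- The indicator function of a point. -/
def pointIndicator (g h : Q8) : ℝ := if h = g then 1 else 0

/-- A continuous function on `M₃` that separates the vertices. -/
def vertexFun : EW → Q8 → ℝ :=
  EW.desc (fun g s t => ((1 - s) * (1 - t)) • classIndicator g +
      (s * (1 - t)) • classIndicator (g * QuaternionGroup.a 1) +
      ((1 - s) * t) • classIndicator (g * QuaternionGroup.xa 0) +
      (s * t) • classIndicator (g * QuaternionGroup.a 1 * QuaternionGroup.xa 0))
    (fun g t _ => by simp) (fun g s _ => by simp [classIndicator_comm])

/-- A continuous function on `M₃` that separates the points of a fibre of the projection that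
do not lie on a horizontal side of a square. -/
def verticalFun : EW → Q8 → ℝ :=
  EW.desc (fun g s t => (t * (1 - t)) • (s • pointIndicator (g * QuaternionGroup.a 1) +
      (1 - s) • pointIndicator g))
    (fun g t _ => by simp) (fun g s _ => by simp)

/-- A continuous function on `M₃` that separates the points of a fibre of the projection that
do not lie on a vertical side of a square. -/
def horizontalFun : EW → Q8 → ℝ :=
  EW.desc (fun g s t => (s * (1 - s)) • (t • pointIndicator (g * QuaternionGroup.xa 0) +
      (1 - t) • pointIndicator g))
    (fun g t _ => by simp) (fun g s _ => by simp)

/-- The weight `1 - s` is positive, so if `g ≠ g'` then comparing values at `g` and at `g'` forces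
`g = g' u` and `g' = g u`, whence `u² = 1`. -/
theorem eq_of_smul_pointIndicator {u : Q8} (hu : u * u ≠ 1) {g g' : Q8} {s : ℝ}
    (hs : s ∈ Set.Ico (0 : ℝ) 1)
    (h : s • pointIndicator (g * u) + (1 - s) • pointIndicator g =
      s • pointIndicator (g' * u) + (1 - s) • pointIndicator g') : g = g' := by
  by_contra hne
  have h1 := congrFun h g
  have h2 := congrFun h g'
  have hu1 : u ≠ 1 := by rintro rfl; simp at hu
  simp only [Pi.add_apply, Pi.smul_apply, pointIndicator, smul_eq_mul, if_neg hne,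
    if_neg (Ne.symm hne), left_eq_mul, hu1, if_true, if_false] at h1 h2
  split_ifs at h1 h2 with h3 h4
  · rw [h3, mul_assoc] at h4
    exact hu (left_eq_mul.1 h4)
  all_goals have := hs.2; linarith

/-- Off the vertices one of the factors `s (1 - s)`, `t (1 - t)` is nonzero and can be cancelled;
then `i² = j² = -1 ≠ 1` applies. -/
theorem eq_of_ewPt_eq {g g' : Q8} {s t : ℝ} (hs : s ∈ Set.Ico (0 : ℝ) 1)
    (ht : t ∈ Set.Ico (0 : ℝ) 1) (hst : s ≠ 0 ∨ t ≠ 0)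
    (h : verticalFun (ewPt g s t) = verticalFun (ewPt g' s t))
    (h' : horizontalFun (ewPt g s t) = horizontalFun (ewPt g' s t)) : g = g' := by
  have hs' := Set.Ico_subset_Icc_self hs
  have ht' := Set.Ico_subset_Icc_self ht
  rcases hst with h0 | h0
  · rw [horizontalFun, EW.desc_ewPt _ hs' ht', EW.desc_ewPt _ hs' ht'] at h'
    refine eq_of_smul_pointIndicator (by decide) ht (smul_right_injective _ ?_ h')
    exact mul_ne_zero h0 (by linarith [hs.2])
  · rw [verticalFun, EW.desc_ewPt _ hs' ht', EW.desc_ewPt _ hs' ht'] at h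
    refine eq_of_smul_pointIndicator (by decide) hs (smul_right_injective _ ?_ h)
    exact mul_ne_zero h0 (by linarith [ht.2])

theorem ewPt_injective {g g' : Q8} {s t : ℝ} (hs : s ∈ Set.Ico (0 : ℝ) 1)
    (ht : t ∈ Set.Ico (0 : ℝ) 1) (hst : s ≠ 0 ∨ t ≠ 0) (h : ewPt g s t = ewPt g' s t) : g = g' :=
  eq_of_ewPt_eq hs ht hst (by rw [h]) (by rw [h])

/-- One turn around the vertex, through the squares below, left, up and right, multiplies by a
commutator of `i` and `j`, which is `-1`. -/
theorem ewPt_zero_zero (g : Q8) : ewPt g 0 0 = ewPt (g * QuaternionGroup.a 2) 0 0 := by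
  have e : g = g * QuaternionGroup.xa 2 * QuaternionGroup.xa 0 := by revert g; decide
  have e1 : g * QuaternionGroup.xa 2 =
    g * QuaternionGroup.xa 2 * QuaternionGroup.a 3 * QuaternionGroup.a 1 := by revert g; decide
  have e2 : g * QuaternionGroup.xa 2 * QuaternionGroup.a 3 * QuaternionGroup.xa 0 *
    QuaternionGroup.a 1 = g * QuaternionGroup.a 2 := by revert g; decide
  calc ewPt g 0 0 = ewPt (g * QuaternionGroup.xa 2) 0 1 := by rw [ewPt_one_right, ← e]
    _ = ewPt (g * QuaternionGroup.xa 2 * QuaternionGroup.a 3) 1 1 := by rw [ewPt_one_left, ← e1]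
    _ = _ := by rw [ewPt_one_right, ewPt_one_left, e2]

theorem Ico_coords_eq {s t s' t' : ℝ} (hs : s ∈ Set.Ico (0 : ℝ) 1) (ht : t ∈ Set.Ico (0 : ℝ) 1)
    (hs' : s' ∈ Set.Ico (0 : ℝ) 1) (ht' : t' ∈ Set.Ico (0 : ℝ) 1)
    (h : toTorus ![s, t] = toTorus ![s', t']) : s = s' ∧ t = t' := by
  have key : ∀ a ∈ Set.Ico (0 : ℝ) 1, ∀ b ∈ Set.Ico (0 : ℝ) 1,
      (a : UnitAddCircle) = (b : UnitAddCircle) → a = b := fun a ha b hb hab =>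
    (AddCircle.coe_eq_coe_iff_of_mem_Ico (p := 1) (a := 0) (by simpa using ha)
      (by simpa using hb)).1 hab
  exact ⟨key s hs s' hs' (congrFun h 0), key t ht t' ht' (congrFun h 1)⟩

/-- Two points in the same fibre of the projection have the same coordinates in two squares. -/
theorem exists_eq_ewPt_of_ewProj_eq {x y : EW} (h : ewProj x = ewProj y) :
    ∃ g g' : Q8, ∃ s ∈ Set.Ico (0 : ℝ) 1, ∃ t ∈ Set.Ico (0 : ℝ) 1,
      x = ewPt g s t ∧ y = ewPt g' s t := by
  obtain ⟨g, s, hs, t, ht, rfl⟩ := exists_eq_ewPt x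
  obtain ⟨g', s', hs', t', ht', rfl⟩ := exists_eq_ewPt y
  rw [ewProj_ewPt _ (Set.Ico_subset_Icc_self hs) (Set.Ico_subset_Icc_self ht),
    ewProj_ewPt _ (Set.Ico_subset_Icc_self hs') (Set.Ico_subset_Icc_self ht')] at h
  obtain ⟨rfl, rfl⟩ := Ico_coords_eq hs ht hs' ht' h
  exact ⟨g, g', s, hs, t, ht, rfl, rfl⟩

/-- The projection and the three auxiliary functions together inject `M₃` continuously into a
Hausdorff space. -/
instance : T2Space EW := by
  have hc : Continuous fun x : EW => (ewProj x, vertexFun x, verticalFun x, horizontalFun x) := by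
    refine continuous_ewProj.prodMk (.prodMk ?_ (.prodMk ?_ ?_)) <;>
    · refine EW.continuous_desc fun g => ?_
      fun_prop
  refine T2Space.of_injective_continuous (fun x y h => ?_) hc
  simp only [Prod.mk.injEq] at h
  obtain ⟨h0, h1, h2, h3⟩ := h
  obtain ⟨g, g', s, hs, t, ht, rfl, rfl⟩ := exists_eq_ewPt_of_ewProj_eq h0
  by_cases hst : s ≠ 0 ∨ t ≠ 0
  · rw [eq_of_ewPt_eq hs ht hst h2 h3]
  · push Not at hst
    obtain ⟨rfl, rfl⟩ := hst
    rw [vertexFun, EW.desc_ewPt _ (by simp) (by simp), EW.desc_ewPt _ (by simp) (by simp)] at h1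
    have h4 := congrFun h1 g
    simp only [sub_zero, mul_one, one_smul, zero_smul, add_zero, mul_zero,
      classIndicator, true_or, if_true] at h4
    split_ifs at h4 with h5
    · rcases h5 with rfl | rfl
      · rfl
      · exact (ewPt_zero_zero g').symm
    · norm_num at h4

theorem finite_ewProj_fibre (P : Torus) : (ewProj ⁻¹' {P}).Finite := by
  by_cases hP : (ewProj ⁻¹' {P}).Nonempty
  · obtain ⟨x, rfl⟩ := hP
    obtain ⟨g, s, hs, t, ht, rfl⟩ := exists_eq_ewPt x
    refine (Set.finite_range fun g' : Q8 => ewPt g' s t).subset fun y hy => ?_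
    obtain ⟨g', s', hs', t', ht', rfl⟩ := exists_eq_ewPt y
    have h : ewProj (ewPt g' s' t') = ewProj (ewPt g s t) := hy
    rw [ewProj_ewPt _ (Set.Ico_subset_Icc_self hs) (Set.Ico_subset_Icc_self ht),
      ewProj_ewPt _ (Set.Ico_subset_Icc_self hs') (Set.Ico_subset_Icc_self ht')] at h
    obtain ⟨rfl, rfl⟩ := Ico_coords_eq hs' ht' hs ht h
    exact ⟨g', rfl⟩
  · rw [Set.not_nonempty_iff_eq_empty.1 hP]
    exact Set.finite_empty

/-- A clopen set contains or misses each square as a whole, the gluing relates neighbouring squares,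
and `i`, `j` generate the quaternion group. -/
instance : PreconnectedSpace EW := by
  refine preconnectedSpace_iff_clopen.2 fun C hC => ?_
  have hsq : ∀ (g : Q8) (s t : ℝ), ewPt g s t ∈ C ↔ ewPt g 0 0 ∈ C := by
    intro g s t
    have := (hC.preimage (continuous_ewPt g))
    rcases isClopen_iff.1 this with h | h
    · have h1 : (s, t) ∉ (fun v : ℝ × ℝ => ewPt g v.1 v.2) ⁻¹' C := by simp [h]
      have h2 : ((0 : ℝ), (0 : ℝ)) ∉ (fun v : ℝ × ℝ => ewPt g v.1 v.2) ⁻¹' C := by simp [h]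
      exact iff_of_false h1 h2
    · have h1 : (s, t) ∈ (fun v : ℝ × ℝ => ewPt g v.1 v.2) ⁻¹' C := by simp [h]
      have h2 : ((0 : ℝ), (0 : ℝ)) ∈ (fun v : ℝ × ℝ => ewPt g v.1 v.2) ⁻¹' C := by simp [h]
      exact iff_of_true h1 h2
  have hi : ∀ g, ewPt (g * QuaternionGroup.a 1) 0 0 ∈ C ↔ ewPt g 0 0 ∈ C := fun g => by
    rw [← ewPt_one_left, hsq]
  have hj : ∀ g, ewPt (g * QuaternionGroup.xa 0) 0 0 ∈ C ↔ ewPt g 0 0 ∈ C := fun g => by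
    rw [← ewPt_one_right, hsq]
  have hpow : ∀ (n : ℕ) (g : Q8), ewPt (g * QuaternionGroup.a 1 ^ n) 0 0 ∈ C ↔ ewPt g 0 0 ∈ C := by
    intro n
    induction n with
    | zero => simp
    | succ n ih => intro g; rw [pow_succ, ← mul_assoc, hi, ih]
  have hall : ∀ g : Q8, ewPt g 0 0 ∈ C ↔ ewPt 1 0 0 ∈ C := by
    intro g
    have hg : ∃ n < 4, g = 1 * QuaternionGroup.a 1 ^ n ∨
        g = 1 * QuaternionGroup.xa 0 * QuaternionGroup.a 1 ^ n := by
      revert g; decide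
    obtain ⟨n, -, rfl | rfl⟩ := hg
    · exact hpow n 1
    · rw [hpow, hj]
  have hpt : ∀ x, x ∈ C ↔ ewPt 1 0 0 ∈ C := fun x => by
    obtain ⟨g, s, -, t, -, rfl⟩ := exists_eq_ewPt x
    rw [hsq, hall]
  by_cases h : ewPt 1 0 0 ∈ C
  · exact Or.inr (Set.eq_univ_of_forall fun x => (hpt x).2 h)
  · exact Or.inl (Set.eq_empty_of_forall_notMem fun x hx => h ((hpt x).1 hx))

/-! ### The projection of `M₃` to the torus -/

/-- Every point of `M₃` lies on a square on which one can move to the right (left) and up (down). -/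
theorem exists_eq_ewPt_of_signs (x : EW) (σ τ : Prop) :
    ∃ g : Q8, ∃ s ∈ Set.Icc (0 : ℝ) 1, ∃ t ∈ Set.Icc (0 : ℝ) 1, x = ewPt g s t ∧
      (σ → s < 1) ∧ (¬σ → 0 < s) ∧ (τ → t < 1) ∧ (¬τ → 0 < t) := by
  obtain ⟨g, s, hs, t, ht, rfl⟩ := exists_eq_ewPt x
  have h1 : ∃ g' : Q8, ∃ s' ∈ Set.Icc (0 : ℝ) 1, ewPt g s t = ewPt g' s' t ∧
      (σ → s' < 1) ∧ (¬σ → 0 < s') := by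
    by_cases hσ : σ ∨ 0 < s
    · exact ⟨g, s, Set.Ico_subset_Icc_self hs, rfl, fun _ => hs.2, fun h => hσ.resolve_left h⟩
    · push Not at hσ
      obtain rfl : s = 0 := le_antisymm hσ.2 hs.1
      refine ⟨g * (QuaternionGroup.a 1)⁻¹, 1, by simp, ?_, fun h => absurd h hσ.1, fun _ => one_pos⟩
      rw [ewPt_one_left, inv_mul_cancel_right]
  obtain ⟨g', s', hs', h1, h2⟩ := h1
  by_cases hτ : τ ∨ 0 < t
  · exact ⟨g', s', hs', t, Set.Ico_subset_Icc_self ht, h1, h2.1, h2.2, fun _ => ht.2,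
      fun h => hτ.resolve_left h⟩
  · push Not at hτ
    obtain rfl : t = 0 := le_antisymm hτ.2 ht.1
    refine ⟨g' * (QuaternionGroup.xa 0)⁻¹, s', hs', 1, by simp, ?_, h2.1, h2.2,
      fun h => absurd h hτ.1, fun _ => one_pos⟩
    rw [ewPt_one_right, inv_mul_cancel_right, h1]

theorem eventually_add_mem_Icc {s : ℝ} (hs : s ∈ Set.Icc (0 : ℝ) 1) (σ : Prop) (h1 : σ → s < 1)
    (h2 : ¬σ → 0 < s) : ∀ᶠ r in 𝓝 (0 : ℝ), (0 ≤ r ↔ σ) → s + r ∈ Set.Icc (0 : ℝ) 1 := by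
  have hc : Tendsto (fun r => s + r) (𝓝 0) (𝓝 s) := by
    simpa using (continuous_const.add continuous_id).tendsto (x := (0 : ℝ)) (f := fun r => s + r)
  by_cases hσ : σ
  · filter_upwards [hc.eventually (gt_mem_nhds (h1 hσ))] with r hr h
    exact ⟨add_nonneg hs.1 (h.2 hσ), hr.le⟩
  · filter_upwards [hc.eventually (lt_mem_nhds (h2 hσ))] with r hr h
    have : r < 0 := not_le.1 fun h' => hσ (h.1 h')
    exact ⟨hr.le, by linarith [hs.2]⟩

/-- Each of the four quadrants of small displacements can be followed inside a single square
containing `x`. This treats vertices, sides and interior points alike. -/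
theorem isOpenMap_ewProj : IsOpenMap ewProj := by
  refine IsOpenMap.of_nhds_le fun x => ?_
  intro V hV
  have hV : ewProj ⁻¹' V ∈ 𝓝 x := hV
  have key : ∀ σ τ : Prop, ∀ᶠ v : Fin 2 → ℝ in 𝓝 0, (0 ≤ v 0 ↔ σ) → (0 ≤ v 1 ↔ τ) →
      ewProj x + toTorus v ∈ V := by
    intro σ τ
    obtain ⟨g, s, hs, t, ht, rfl, h1, h2, h3, h4⟩ := exists_eq_ewPt_of_signs x σ τ
    have hc : Tendsto (fun v : Fin 2 → ℝ => ewPt g (s + v 0) (t + v 1)) (𝓝 0)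
        (𝓝 (ewPt g s t)) := by
      have : Continuous fun v : Fin 2 → ℝ => ewPt g (s + v 0) (t + v 1) :=
        Continuous.ewPt g (by fun_prop) (by fun_prop)
      simpa using this.tendsto 0
    have h0 : Tendsto (fun v : Fin 2 → ℝ => v 0) (𝓝 0) (𝓝 0) := (continuous_apply 0).tendsto _
    have h0' : Tendsto (fun v : Fin 2 → ℝ => v 1) (𝓝 0) (𝓝 0) := (continuous_apply 1).tendsto _
    filter_upwards [hc hV, h0.eventually (eventually_add_mem_Icc hs σ h1 h2),
      h0'.eventually (eventually_add_mem_Icc ht τ h3 h4)] with v hv hv0 hv1 hσ hτ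
    have hv : ewProj (ewPt g (s + v 0) (t + v 1)) ∈ V := hv
    rw [ewProj_ewPt _ (hv0 hσ) (hv1 hτ)] at hv
    rw [ewProj_ewPt _ hs ht, ← toTorus_add]
    convert hv using 2
    ext i
    fin_cases i <;> simp
  have hall : ∀ᶠ v : Fin 2 → ℝ in 𝓝 0, ewProj x + toTorus v ∈ V := by
    filter_upwards [key True True, key True False, key False True, key False False]
      with v h1 h2 h3 h4
    by_cases h : 0 ≤ v 0 <;> by_cases h' : 0 ≤ v 1 <;> simp_all
  filter_upwards [(tendsto_smallLift_sub (ewProj x)).eventually hall] with P hP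
  rwa [toTorus_smallLift, add_sub_cancel] at hP

/-- Over the origin, the projection is nowhere locally injective. -/
theorem not_injOn_ewProj {x : EW} (hx : ewProj x = 0) {U : Set EW} (hU : U ∈ 𝓝 x) :
    ¬Set.InjOn ewProj U := by
  obtain ⟨g, s, hs, t, ht, rfl⟩ := exists_eq_ewPt x
  have h0 : (0 : ℝ) ∈ Set.Ico (0 : ℝ) 1 := by simp
  rw [ewProj_ewPt _ (Set.Ico_subset_Icc_self hs) (Set.Ico_subset_Icc_self ht)] at hx
  obtain ⟨rfl, rfl⟩ := Ico_coords_eq hs ht h0 h0 (hx.trans (by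
    rw [← toTorus_zero]; congr 1; ext i; fin_cases i <;> rfl))
  -- The diagonals of `sq(g)` and `sq(-g)` start at the same vertex and have the same projection.
  have hc : ∀ g', Tendsto (fun r : ℝ => ewPt g' r r) (𝓝[>] 0) (𝓝 (ewPt g' 0 0)) := fun g' =>
    ((Continuous.ewPt g' continuous_id continuous_id).tendsto 0).mono_left nhdsWithin_le_nhds
  have h1 := (hc g).eventually hU
  have h2 := (hc (g * QuaternionGroup.a 2)).eventually (ewPt_zero_zero g ▸ hU)
  obtain ⟨r, ⟨hr1, hr2⟩, hr⟩ :=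
    ((h1.and h2).and (Ioo_mem_nhdsGT (zero_lt_one' ℝ))).exists
  intro hinj
  have hI : r ∈ Set.Ico (0 : ℝ) 1 := ⟨hr.1.le, hr.2⟩
  have hI' := Set.Ico_subset_Icc_self hI
  have := ewPt_injective hI hI (Or.inl hr.1.ne')
    (hinj hr1 hr2 (by rw [ewProj_ewPt _ hI' hI', ewProj_ewPt _ hI' hI']))
  rw [left_eq_mul] at this
  exact absurd this (by decide)

/-! ### Deck transformations and affine lifts -/

/-- The deck transformation of `M₃` given by left multiplication. -/
noncomputable def deckMap (h : Q8) : EW → EW :=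
  EW.desc (fun g s t => ewPt (h * g) s t)
    (fun g t _ => by rw [ewPt_one_left, mul_assoc]) (fun g s _ => by rw [ewPt_one_right, mul_assoc])

theorem deckMap_ewPt (h g : Q8) {s t : ℝ} (hs : s ∈ Set.Icc (0 : ℝ) 1)
    (ht : t ∈ Set.Icc (0 : ℝ) 1) : deckMap h (ewPt g s t) = ewPt (h * g) s t :=
  EW.desc_ewPt g hs ht

theorem deckMap_mul (h h' : Q8) (x : EW) : deckMap h (deckMap h' x) = deckMap (h * h') x := by
  obtain ⟨g, s, hs, t, ht, rfl⟩ := exists_eq_ewPt x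
  have hs := Set.Ico_subset_Icc_self hs
  have ht := Set.Ico_subset_Icc_self ht
  rw [deckMap_ewPt _ _ hs ht, deckMap_ewPt _ _ hs ht, deckMap_ewPt _ _ hs ht, mul_assoc]

theorem deckMap_one (x : EW) : deckMap 1 x = x := by
  obtain ⟨g, s, hs, t, ht, rfl⟩ := exists_eq_ewPt x
  rw [deckMap_ewPt _ _ (Set.Ico_subset_Icc_self hs) (Set.Ico_subset_Icc_self ht), one_mul]

/-- The deck transformations as homeomorphisms. -/
noncomputable def deck (h : Q8) : EW ≃ₜ EW where
  toFun := deckMap h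
  invFun := deckMap h⁻¹
  left_inv x := by rw [deckMap_mul, inv_mul_cancel, deckMap_one]
  right_inv x := by rw [deckMap_mul, mul_inv_cancel, deckMap_one]
  continuous_toFun := EW.continuous_desc fun g => continuous_ewPt (h * g)
  continuous_invFun := EW.continuous_desc fun g => continuous_ewPt (h⁻¹ * g)

theorem deck_ewPt (h g : Q8) {s t : ℝ} (hs : s ∈ Set.Icc (0 : ℝ) 1)
    (ht : t ∈ Set.Icc (0 : ℝ) 1) : deck h (ewPt g s t) = ewPt (h * g) s t :=
  deckMap_ewPt h g hs ht

theorem ewProj_deck (h : Q8) (x : EW) : ewProj (deck h x) = ewProj x := by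
  obtain ⟨g, s, hs, t, ht, rfl⟩ := exists_eq_ewPt x
  have hs := Set.Ico_subset_Icc_self hs
  have ht := Set.Ico_subset_Icc_self ht
  rw [deck_ewPt _ _ hs ht, ewProj_ewPt _ hs ht, ewProj_ewPt _ hs ht]

theorem exists_deck_eq {x y : EW} (h : ewProj x = ewProj y) : ∃ k, deck k x = y := by
  obtain ⟨g, g', s, hs, t, ht, rfl, rfl⟩ := exists_eq_ewPt_of_ewProj_eq h
  refine ⟨g' * g⁻¹, ?_⟩
  rw [deck_ewPt _ _ (Set.Ico_subset_Icc_self hs) (Set.Ico_subset_Icc_self ht),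
    inv_mul_cancel_right]

/-- Off the vertices a point determines the square containing it in half-open coordinates. The
vertices must be excluded because `-1` fixes each of them. -/
theorem deck_injective {x : EW} (hx : ewProj x ≠ 0) {k k' : Q8} (h : deck k x = deck k' x) :
    k = k' := by
  obtain ⟨g, s, hs, t, ht, rfl⟩ := exists_eq_ewPt x
  have hs' := Set.Ico_subset_Icc_self hs
  have ht' := Set.Ico_subset_Icc_self ht
  rw [deck_ewPt _ _ hs' ht', deck_ewPt _ _ hs' ht'] at h
  refine mul_right_cancel (ewPt_injective hs ht ?_ h)
  by_contra! hst
  obtain ⟨rfl, rfl⟩ := hst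
  refine hx ?_
  rw [ewProj_ewPt _ hs' ht', ← toTorus_zero]
  congr 1; ext i; fin_cases i <;> rfl

/-- `g` is an affine lift of the endomorphism of the torus given by `γ`. -/
def IsLiftOf (γ : Matrix.SpecialLinearGroup (Fin 2) ℤ) (g : EW ≃ₜ EW) : Prop :=
  ∀ x, ewProj (g x) = torusEnd γ.1 (ewProj x)

/-- The automorphism `i ↦ j`, `j ↦ -i` of the quaternion group. -/
def rotAut : Q8 → Q8
  | .a n => QuaternionGroup.xa 0 ^ n.val
  | .xa n => QuaternionGroup.a 3 * QuaternionGroup.xa 0 ^ n.val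

/-- The automorphism `i ↦ i`, `j ↦ k` of the quaternion group. -/
def shearAut : Q8 → Q8
  | .a n => .a n
  | .xa n => .xa (n - 1)

/-- The automorphism `i ↦ i`, `j ↦ -k` of the quaternion group. -/
def shearAutInv : Q8 → Q8
  | .a n => .a n
  | .xa n => .xa (n + 1)

/-- The rotation by a quarter turn. -/
noncomputable def rotMap : EW → EW :=
  EW.desc (fun g s t => ewPt (rotAut g) (1 - t) s)
    (fun g t _ => by
      rw [ewPt_one_right]
      exact congrArg (ewPt · _ _) ((by decide :
        ∀ g, rotAut g * QuaternionGroup.xa 0 = rotAut (g * QuaternionGroup.a 1)) g))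
    (fun g s _ => by
      rw [sub_self, sub_zero, ewPt_one_left]
      exact congrArg (ewPt · _ _) ((by decide :
        ∀ g, rotAut g = rotAut (g * QuaternionGroup.xa 0) * QuaternionGroup.a 1) g))

theorem rotMap_ewPt (g : Q8) {s t : ℝ} (hs : s ∈ Set.Icc (0 : ℝ) 1)
    (ht : t ∈ Set.Icc (0 : ℝ) 1) : rotMap (ewPt g s t) = ewPt (rotAut g) (1 - t) s :=
  EW.desc_ewPt g hs ht

theorem continuous_rotMap : Continuous rotMap :=
  EW.continuous_desc fun g => Continuous.ewPt _ (by fun_prop) (by fun_prop)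

theorem rotMap_four (x : EW) : rotMap (rotMap (rotMap (rotMap x))) = x := by
  obtain ⟨g, s, hs, t, ht, rfl⟩ := exists_eq_ewPt x
  have hs := Set.Ico_subset_Icc_self hs
  have ht := Set.Ico_subset_Icc_self ht
  have hs' : 1 - s ∈ Set.Icc (0 : ℝ) 1 := ⟨by linarith [hs.2], by linarith [hs.1]⟩
  have ht' : 1 - t ∈ Set.Icc (0 : ℝ) 1 := ⟨by linarith [ht.2], by linarith [ht.1]⟩
  rw [rotMap_ewPt _ hs ht, rotMap_ewPt _ ht' hs, rotMap_ewPt _ hs' ht',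
    rotMap_ewPt _ (by simpa using ht) hs', sub_sub_cancel, sub_sub_cancel]
  exact congrArg (ewPt · _ _) ((by decide : ∀ g, rotAut (rotAut (rotAut (rotAut g))) = g) g)

/-- The rotation by a quarter turn as a homeomorphism. -/
noncomputable def rot : EW ≃ₜ EW where
  toFun := rotMap
  invFun := rotMap ∘ rotMap ∘ rotMap
  left_inv := rotMap_four
  right_inv := rotMap_four
  continuous_toFun := continuous_rotMap
  continuous_invFun := continuous_rotMap.comp (continuous_rotMap.comp continuous_rotMap)

theorem isLiftOf_rot : IsLiftOf ModularGroup.S rot := by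
  intro x
  obtain ⟨g, s, hs, t, ht, rfl⟩ := exists_eq_ewPt x
  have hs := Set.Ico_subset_Icc_self hs
  have ht := Set.Ico_subset_Icc_self ht
  have ht' : 1 - t ∈ Set.Icc (0 : ℝ) 1 := ⟨by linarith [ht.2], by linarith [ht.1]⟩
  have e : rot (ewPt g s t) = rotMap (ewPt g s t) := rfl
  rw [e, rotMap_ewPt _ hs ht, ewProj_ewPt _ ht' hs, ewProj_ewPt _ hs ht, torusEnd_toTorus,
    toTorus_eq_iff]
  intro i
  fin_cases i
  · exact ⟨1, by simp [ModularGroup.S, Matrix.mulVec, dotProduct, Fin.sum_univ_two]⟩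
  · exact ⟨0, by simp [ModularGroup.S, Matrix.mulVec, dotProduct, Fin.sum_univ_two]⟩

/-- The horizontal shear. -/
noncomputable def shearMap : EW → EW :=
  -- The sheared square crosses a vertical side along `s + t = 1`; what lies beyond belongs to the
  -- square on its right.
  EW.desc (fun g s t => if s + t ≤ 1 then ewPt (shearAut g) (s + t) t
      else ewPt (shearAut g * QuaternionGroup.a 1) (s + t - 1) t)
    (fun g t ht => by
      have e : shearAut g * QuaternionGroup.a 1 = shearAut (g * QuaternionGroup.a 1) := by
        revert g; decide
      rw [zero_add, if_pos ht.2, ← e]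
      split_ifs with h
      · obtain rfl : t = 0 := le_antisymm (by linarith) ht.1
        rw [add_zero, ewPt_one_left]
      · rw [add_sub_cancel_left])
    (fun g s hs => by
      have e : shearAut g * QuaternionGroup.a 1 * QuaternionGroup.xa 0 =
        shearAut (g * QuaternionGroup.xa 0) := by revert g; decide
      rw [add_zero, if_pos hs.2, ← e]
      split_ifs with h
      · obtain rfl : s = 0 := le_antisymm (by linarith) hs.1
        rw [zero_add, ewPt_one_left, ewPt_one_right]
      · rw [add_sub_cancel_right, ewPt_one_right])

/-- The inverse of the horizontal shear. -/
noncomputable def shearMapInv : EW → EW :=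
  EW.desc (fun g s t => if t ≤ s then ewPt (shearAutInv g) (s - t) t
      else ewPt (shearAutInv g * QuaternionGroup.a 3) (s - t + 1) t)
    (fun g t ht => by
      have e : shearAutInv g =
        shearAutInv (g * QuaternionGroup.a 1) * QuaternionGroup.a 3 := by revert g; decide
      rw [if_pos ht.2]
      split_ifs with h
      · obtain rfl : t = 0 := le_antisymm h ht.1
        rw [sub_self, sub_zero, ewPt_one_left]
        exact congrArg (ewPt · _ _) ((by decide : ∀ g, shearAutInv g * QuaternionGroup.a 1 =
          shearAutInv (g * QuaternionGroup.a 1)) g)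
      · rw [← e, zero_sub, neg_add_eq_sub])
    (fun g s hs => by
      rw [if_pos hs.1, sub_zero]
      split_ifs with h
      · obtain rfl : s = 1 := le_antisymm hs.2 h
        -- At this corner the two descriptions end in squares that differ by `-1`, which share the
        -- vertex.
        rw [sub_self, ewPt_one_right, ewPt_one_left, ewPt_zero_zero]
        exact congrArg (ewPt · _ _) ((by decide : ∀ g, shearAutInv g * QuaternionGroup.xa 0 *
          QuaternionGroup.a 2 = shearAutInv (g * QuaternionGroup.xa 0) * QuaternionGroup.a 1) g)
      · rw [sub_add_cancel, ewPt_one_right]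
        exact congrArg (ewPt · _ _) ((by decide : ∀ g, shearAutInv g * QuaternionGroup.a 3 *
          QuaternionGroup.xa 0 = shearAutInv (g * QuaternionGroup.xa 0)) g))

theorem shearMap_ewPt (g : Q8) {s t : ℝ} (hs : s ∈ Set.Icc (0 : ℝ) 1)
    (ht : t ∈ Set.Icc (0 : ℝ) 1) : shearMap (ewPt g s t) =
      if s + t ≤ 1 then ewPt (shearAut g) (s + t) t
      else ewPt (shearAut g * QuaternionGroup.a 1) (s + t - 1) t :=
  EW.desc_ewPt g hs ht

theorem shearMapInv_ewPt (g : Q8) {s t : ℝ} (hs : s ∈ Set.Icc (0 : ℝ) 1)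
    (ht : t ∈ Set.Icc (0 : ℝ) 1) : shearMapInv (ewPt g s t) =
      if t ≤ s then ewPt (shearAutInv g) (s - t) t
      else ewPt (shearAutInv g * QuaternionGroup.a 3) (s - t + 1) t :=
  EW.desc_ewPt g hs ht

theorem continuous_shearMap : Continuous shearMap := by
  refine EW.continuous_desc fun g => ?_
  refine Continuous.if_le (Continuous.ewPt _ (by fun_prop) (by fun_prop))
    (Continuous.ewPt _ (by fun_prop) (by fun_prop)) (by fun_prop) (by fun_prop) fun v hv => ?_
  rw [hv, sub_self, ewPt_one_left]

theorem continuous_shearMapInv : Continuous shearMapInv := by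
  refine EW.continuous_desc fun g => ?_
  refine Continuous.if_le (Continuous.ewPt _ (by fun_prop) (by fun_prop))
    (Continuous.ewPt _ (by fun_prop) (by fun_prop)) (by fun_prop) (by fun_prop) fun v hv => ?_
  rw [hv, sub_self, zero_add, ewPt_one_left]
  exact congrArg (ewPt · _ _) ((by decide : ∀ g, shearAutInv g =
    shearAutInv g * QuaternionGroup.a 3 * QuaternionGroup.a 1) g)

theorem shearMapInv_shearMap (x : EW) : shearMapInv (shearMap x) = x := by
  obtain ⟨g, s, hs, t, ht, rfl⟩ := exists_eq_ewPt x
  rw [shearMap_ewPt _ (Set.Ico_subset_Icc_self hs) (Set.Ico_subset_Icc_self ht)]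
  split_ifs with h
  · rw [shearMapInv_ewPt _ ⟨add_nonneg hs.1 ht.1, h⟩ (Set.Ico_subset_Icc_self ht),
      if_pos (by linarith [hs.1]), add_sub_cancel_right]
    exact congrArg (ewPt · _ _) ((by decide : ∀ g, shearAutInv (shearAut g) = g) g)
  · rw [shearMapInv_ewPt _ ⟨by linarith, by linarith [hs.2, ht.2]⟩ (Set.Ico_subset_Icc_self ht),
      if_neg (by linarith [hs.2]), show s + t - 1 - t + 1 = s by ring]
    exact congrArg (ewPt · _ _) ((by decide : ∀ g, shearAutInv
      (shearAut g * QuaternionGroup.a 1) * QuaternionGroup.a 3 = g) g)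

theorem shearMap_shearMapInv (x : EW) : shearMap (shearMapInv x) = x := by
  obtain ⟨g, s, hs, t, ht, rfl⟩ := exists_eq_ewPt x
  rw [shearMapInv_ewPt _ (Set.Ico_subset_Icc_self hs) (Set.Ico_subset_Icc_self ht)]
  split_ifs with h
  · rw [shearMap_ewPt _ ⟨by linarith, by linarith [hs.2, ht.1]⟩ (Set.Ico_subset_Icc_self ht),
      if_pos (by linarith [hs.2]), sub_add_cancel]
    exact congrArg (ewPt · _ _) ((by decide : ∀ g, shearAut (shearAutInv g) = g) g)
  · have e : shearAut (shearAutInv g * QuaternionGroup.a 3) * QuaternionGroup.a 1 = g := by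
      revert g; decide
    rw [shearMap_ewPt _ ⟨by linarith [hs.1, ht.2], by linarith⟩ (Set.Ico_subset_Icc_self ht), e,
      show s - t + 1 + t = s + 1 by ring, add_sub_cancel_right]
    split_ifs with h'
    · obtain rfl : s = 0 := le_antisymm (by linarith) hs.1
      rw [zero_add, ewPt_one_left]
      exact congrArg (ewPt · _ _) ((by decide : ∀ g, shearAut
        (shearAutInv g * QuaternionGroup.a 3) * QuaternionGroup.a 1 = g) g)
    · rfl

/-- The horizontal shear as a homeomorphism. -/
noncomputable def shear : EW ≃ₜ EW where
  toFun := shearMap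
  invFun := shearMapInv
  left_inv := shearMapInv_shearMap
  right_inv := shearMap_shearMapInv
  continuous_toFun := continuous_shearMap
  continuous_invFun := continuous_shearMapInv

theorem isLiftOf_shear : IsLiftOf ModularGroup.T shear := by
  intro x
  obtain ⟨g, s, hs, t, ht, rfl⟩ := exists_eq_ewPt x
  have hs' := Set.Ico_subset_Icc_self hs
  have ht' := Set.Ico_subset_Icc_self ht
  have e : shear (ewPt g s t) = shearMap (ewPt g s t) := rfl
  rw [e, shearMap_ewPt _ hs' ht', ewProj_ewPt _ hs' ht', torusEnd_toTorus]
  split_ifs with h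
  · rw [ewProj_ewPt _ ⟨add_nonneg hs.1 ht.1, h⟩ ht']
    congr 1
    ext i
    fin_cases i <;> simp [ModularGroup.T, Matrix.mulVec, dotProduct, Fin.sum_univ_two]
  · rw [ewProj_ewPt _ ⟨by linarith, by linarith [hs.2, ht.2]⟩ ht', toTorus_eq_iff]
    intro i
    fin_cases i
    · exact ⟨-1, by simp [ModularGroup.T, Matrix.mulVec, dotProduct, Fin.sum_univ_two]⟩
    · exact ⟨0, by simp [ModularGroup.T, Matrix.mulVec, dotProduct, Fin.sum_univ_two]⟩

theorem IsLiftOf.mul {γ δ : Matrix.SpecialLinearGroup (Fin 2) ℤ} {g h : EW ≃ₜ EW}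
    (hg : IsLiftOf γ g) (hh : IsLiftOf δ h) : IsLiftOf (γ * δ) (h.trans g) := fun x => by
  rw [Matrix.SpecialLinearGroup.coe_mul, torusEnd_mul, ← hh, ← hg]
  rfl

theorem IsLiftOf.inv {γ : Matrix.SpecialLinearGroup (Fin 2) ℤ} {g : EW ≃ₜ EW}
    (hg : IsLiftOf γ g) : IsLiftOf γ⁻¹ g.symm := fun x => by
  have h := hg (g.symm x)
  rw [g.apply_symm_apply] at h
  rw [h, ← torusEnd_mul, ← Matrix.SpecialLinearGroup.coe_mul, inv_mul_cancel,
    Matrix.SpecialLinearGroup.coe_one, torusEnd_one]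

/-- The Veech group of `M₃` is the full modular group. -/
theorem exists_isLiftOf (γ : Matrix.SpecialLinearGroup (Fin 2) ℤ) : ∃ g, IsLiftOf γ g := by
  have hγ : γ ∈ Subgroup.closure {ModularGroup.S, ModularGroup.T} := by
    rw [SpecialLinearGroup.SL2Z_generators]
    trivial
  induction hγ using Subgroup.closure_induction with
  | mem x hx =>
    rcases hx with rfl | rfl
    · exact ⟨rot, isLiftOf_rot⟩
    · exact ⟨shear, isLiftOf_shear⟩
  | one => exact ⟨Homeomorph.refl _, fun x => (torusEnd_one _).symm⟩
  | mul x y _ _ hx hy =>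
    obtain ⟨g, hg⟩ := hx
    obtain ⟨h, hh⟩ := hy
    exact ⟨_, hg.mul hh⟩
  | inv x _ hx =>
    obtain ⟨g, hg⟩ := hx
    exact ⟨_, hg.inv⟩

/-! ### Local forms -/

section LocalForm

variable {X Y : Type*} [TopologicalSpace X] [TopologicalSpace Y]

/-- The power map is open at `0` by the open mapping theorem, and the charts transport this to `p`.
-/
theorem HasLocalForm.nhds_le {p : X → Y} {x : X} {n : ℕ} (h : HasLocalForm p x n) :
    𝓝 (p x) ≤ map p (𝓝 x) := by
  obtain ⟨hn, φ, ψ, hx, hpx, hφ, hψ, hpow⟩ := h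
  have hc : 𝓝 (0 : ℂ) ≤ map (fun z : ℂ => z ^ n) (𝓝 0) := by
    have ha : AnalyticAt ℂ (fun z : ℂ => z ^ n) 0 := analyticAt_id.pow n
    rcases ha.eventually_constant_or_nhds_le_map_nhds with h | h
    · exfalso
      have h' : ∀ᶠ z : ℂ in 𝓝[≠] 0, z ^ n = 0 :=
        (h.filter_mono nhdsWithin_le_nhds).mono fun z hz => by rw [hz, zero_pow hn.ne']
      obtain ⟨z, hz, hz0⟩ := (h'.and self_mem_nhdsWithin).exists
      exact pow_ne_zero n hz0 hz
    · rwa [zero_pow hn.ne'] at h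
  have heq : p =ᶠ[𝓝 x] fun y => ψ.symm (φ y ^ n) := by
    filter_upwards [φ.open_source.mem_nhds hx] with y hy
    rw [← (hpow y hy).2, ψ.left_inv (hpow y hy).1]
  have h0 : (0 : ℂ) ∈ ψ.target := hψ ▸ ψ.map_source hpx
  calc 𝓝 (p x) = map ψ.symm (𝓝 0) := by
        rw [ψ.symm.map_nhds_eq h0, ← hψ, ψ.left_inv hpx]
    _ ≤ map ψ.symm (map (fun z : ℂ => z ^ n) (map φ (𝓝 x))) := by
        rw [φ.map_nhds_eq hx, hφ]
        exact map_mono hc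
    _ = map p (𝓝 x) := by
        rw [map_map, map_map]
        exact (map_congr heq).symm

theorem HasLocalForm.eventually_ne {p : X → Y} {x : X} {n : ℕ} (h : HasLocalForm p x n) :
    ∀ᶠ y in 𝓝[≠] x, p y ≠ p x := by
  obtain ⟨hn, φ, ψ, hx, hpx, hφ, hψ, hpow⟩ := h
  filter_upwards [nhdsWithin_le_nhds (φ.open_source.mem_nhds hx), self_mem_nhdsWithin]
    with y hy hne heq
  have h1 := (hpow y hy).2
  rw [heq, hψ] at h1
  exact hne (φ.injOn hy hx (by rw [hφ, eq_zero_of_pow_eq_zero h1.symm]))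

/-! ### Punctured neighbourhoods and continuation across finite sets -/

theorem isPreconnected_punctured_ball {r : ℝ} :
    IsPreconnected (Metric.ball (0 : ℂ) r \ {0}) := by
  have h : Metric.ball (0 : ℂ) r \ {0} =
      (fun v : ℝ × ℝ => (v.1 : ℂ) * Complex.exp (v.2 * Complex.I)) ''
        (Set.Ioo 0 r ×ˢ Set.univ) := by
    ext z
    simp only [Set.mem_sdiff, mem_ball_zero_iff, Set.mem_singleton_iff, Set.mem_image, Set.mem_prod,
      Set.mem_Ioo, Set.mem_univ, and_true, Prod.exists]
    constructor
    · rintro ⟨h1, h2⟩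
      exact ⟨‖z‖, z.arg, ⟨norm_pos_iff.2 h2, h1⟩, Complex.norm_mul_exp_arg_mul_I z⟩
    · rintro ⟨a, b, ⟨ha, hb⟩, rfl⟩
      rw [norm_mul, Complex.norm_exp_ofReal_mul_I, mul_one, Complex.norm_real, Real.norm_eq_abs,
        abs_of_pos ha]
      exact ⟨hb, mul_ne_zero (by exact_mod_cast ha.ne') (Complex.exp_ne_zero _)⟩
  rw [h]
  exact (isPreconnected_Ioo.prod isPreconnected_univ).image _ (by fun_prop)

/-- Every neighbourhood of a point contains a neighbourhood that stays connected when the point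
is removed, and no point is isolated. -/
def IsPuncturedConnected (X : Type*) [TopologicalSpace X] : Prop :=
  ∀ x : X, (𝓝[≠] x).NeBot ∧ ∀ V ∈ 𝓝 x, ∃ U ∈ 𝓝 x, U ⊆ V ∧ IsPreconnected (U \ {x})

theorem IsRamifiedCovering.isPuncturedConnected {p : X → Y} (hp : IsRamifiedCovering p) :
    IsPuncturedConnected X := by
  intro x
  obtain ⟨n, -, φ, -, hx, -, hφ, -⟩ := hp.2 x
  have h0 : (0 : ℂ) ∈ φ.target := hφ ▸ φ.map_source hx
  have hx' : φ.symm 0 = x := by rw [← hφ, φ.left_inv hx]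
  have hpre : ∀ V ∈ 𝓝 x, ∃ r > 0, Metric.ball 0 r ⊆ φ.target ∧
      φ.symm '' Metric.ball 0 r ⊆ V ∧ φ.symm '' Metric.ball 0 r ∈ 𝓝 x := by
    intro V hV
    have h1 : φ.symm ⁻¹' V ∈ 𝓝 (0 : ℂ) := by
      have := φ.symm.continuousAt h0
      exact this (by rwa [hx'])
    obtain ⟨r, hr, hsub⟩ := Metric.mem_nhds_iff.1 (inter_mem h1 (φ.open_target.mem_nhds h0))
    refine ⟨r, hr, fun z hz => (hsub hz).2, Set.image_subset_iff.2 fun z hz => (hsub hz).1, ?_⟩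
    have := image_mem_map (m := φ.symm) (Metric.ball_mem_nhds (0 : ℂ) hr)
    rwa [φ.symm.map_nhds_eq h0, hx'] at this
  have hdiff : ∀ r, Metric.ball 0 r ⊆ φ.target →
      φ.symm '' Metric.ball 0 r \ {x} = φ.symm '' (Metric.ball 0 r \ {0}) := by
    intro r hr
    ext y
    constructor
    · rintro ⟨⟨z, hz, rfl⟩, hne⟩
      exact ⟨z, ⟨hz, fun h => hne (by rw [Set.mem_singleton_iff.1 h, hx']; rfl)⟩, rfl⟩
    · rintro ⟨z, ⟨hz, hne⟩, rfl⟩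
      exact ⟨⟨z, hz, rfl⟩, fun h => hne (φ.symm.injOn (hr hz) h0 (h.trans hx'.symm))⟩
  refine ⟨?_, fun V hV => ?_⟩
  · rw [← mem_closure_iff_nhdsWithin_neBot, mem_closure_iff_nhds]
    intro V hV
    obtain ⟨r, hr, hrt, hrV, -⟩ := hpre V hV
    have hz : (↑(r / 2) : ℂ) ∈ Metric.ball (0 : ℂ) r \ {0} := by
      refine ⟨?_, by simpa using hr.ne'⟩
      rw [mem_ball_zero_iff, Complex.norm_real, Real.norm_eq_abs, abs_of_pos (by linarith)]
      linarith
    have h := Set.mem_image_of_mem φ.symm hz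
    rw [← hdiff r hrt] at h
    exact ⟨_, hrV h.1, h.2⟩
  · obtain ⟨r, hr, hrt, hrV, hrn⟩ := hpre V hV
    refine ⟨_, hrn, hrV, ?_⟩
    rw [hdiff r hrt]
    exact isPreconnected_punctured_ball.image _
      (φ.symm.continuousOn.mono fun z hz => hrt hz.1)

theorem Set.Finite.eventually_nhdsNE_notMem [T1Space X]
    {S : Set X} (hS : S.Finite) (x : X) : ∀ᶠ y in 𝓝[≠] x, y ∉ S := by
  have : (S \ {x})ᶜ ∈ 𝓝 x :=
    (hS.subset Set.sdiff_subset).isClosed.isOpen_compl.mem_nhds (by simp)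
  filter_upwards [nhdsWithin_le_nhds this, self_mem_nhdsWithin] with y h1 h2 h3
  exact h1 ⟨h3, h2⟩

/-- A condition that is locally constant off a finite set is constant off that set. -/
theorem IsPuncturedConnected.forall_or_forall [T2Space X] [PreconnectedSpace X]
    (hX : IsPuncturedConnected X) {S : Set X} (hS : S.Finite) {P : X → Prop}
    (hP : ∀ x ∉ S, (∀ᶠ y in 𝓝 x, P y) ∨ ∀ᶠ y in 𝓝 x, ¬P y) :
    (∀ x ∉ S, P x) ∨ ∀ x ∉ S, ¬P x := by
  -- Germs on punctured neighbourhoods make sense at the points of `S` as well, so connectedness of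
  -- all of `X` can be used.
  have hopen : ∀ Q : X → Prop, IsOpen {x | ∀ᶠ y in 𝓝[≠] x, Q y} := by
    intro Q
    refine isOpen_iff_mem_nhds.2 fun x hx => ?_
    have hx : ∀ᶠ y in 𝓝[≠] x, Q y := hx
    filter_upwards [eventually_eventually_nhds.2 (eventually_nhdsWithin_iff.1 hx)] with y hy
    rcases eq_or_ne y x with rfl | hne
    · exact hx
    · refine Filter.Eventually.filter_mono nhdsWithin_le_nhds ?_
      filter_upwards [hy, isOpen_ne.mem_nhds hne] with z hz hz'
      exact hz hz'
  have hor : ∀ x, (∀ᶠ y in 𝓝[≠] x, P y) ∨ ∀ᶠ y in 𝓝[≠] x, ¬P y := by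
    intro x
    have hV : (S \ {x})ᶜ ∈ 𝓝 x := (hS.subset Set.sdiff_subset).isClosed.isOpen_compl.mem_nhds
      (by simp)
    obtain ⟨U, hU, hUV, hUc⟩ := (hX x).2 _ hV
    have hU' : U \ {x} ∈ 𝓝[≠] x := inter_mem (nhdsWithin_le_nhds hU) self_mem_nhdsWithin
    have := hUc.subset_or_subset (u := {x | ∀ᶠ y in 𝓝 x, P y}) (v := {x | ∀ᶠ y in 𝓝 x, ¬P y})
      isOpen_setOfPred_eventually_nhds isOpen_setOfPred_eventually_nhds
      (Set.disjoint_left.2 fun y (h : ∀ᶠ z in 𝓝 y, P z) (h' : ∀ᶠ z in 𝓝 y, ¬P z) =>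
        h'.self_of_nhds h.self_of_nhds)
      (fun y hy => hP y fun hyS => hUV hy.1 ⟨hyS, hy.2⟩)
    rcases this with h | h
    · exact Or.inl (mem_of_superset hU' fun y hy => (h hy : ∀ᶠ z in 𝓝 y, P z).self_of_nhds)
    · exact Or.inr (mem_of_superset hU' fun y hy => (h hy : ∀ᶠ z in 𝓝 y, ¬P z).self_of_nhds)
  have huniv := isPreconnected_univ.subset_or_subset (hopen P) (hopen fun y => ¬P y)
    (Set.disjoint_left.2 fun y (h : ∀ᶠ z in 𝓝[≠] y, P z) (h' : ∀ᶠ z in 𝓝[≠] y, ¬P z) => by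
      have := (hX y).1
      obtain ⟨z, hz, hz'⟩ := (h.and h').exists
      exact hz' hz)
    (fun x _ => hor x)
  rcases huniv with h | h
  · refine Or.inl fun x hx => (hP x hx).elim (fun h' => h'.self_of_nhds) fun h' => ?_
    have := (hX x).1
    obtain ⟨z, hz, hz'⟩ := ((h'.filter_mono nhdsWithin_le_nhds).and
      (h (Set.mem_univ x) : ∀ᶠ z in 𝓝[≠] x, P z)).exists
    exact absurd hz' hz
  · refine Or.inr fun x hx => (hP x hx).elim (fun h' => ?_) fun h' => h'.self_of_nhds
    have := (hX x).1
    obtain ⟨z, hz, hz'⟩ := ((h'.filter_mono nhdsWithin_le_nhds).and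
      (h (Set.mem_univ x) : ∀ᶠ z in 𝓝[≠] x, ¬P z)).exists
    exact absurd hz hz'

/-! ### Openness, finite fibres and unramified points -/

theorem IsRamifiedCovering.isOpenMap {p : X → Y} (hp : IsRamifiedCovering p) : IsOpenMap p :=
  IsOpenMap.of_nhds_le fun x => (hp.2 x).choose_spec.nhds_le

/-- An infinite fibre would accumulate somewhere by compactness. The local form excludes this at
points of the fibre, continuity elsewhere. -/
theorem IsRamifiedCovering.finite_fibre [CompactSpace X] [T1Space Y] {p : X → Y}
    (hp : IsRamifiedCovering p) (y : Y) : (p ⁻¹' {y}).Finite := by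
  by_contra h
  obtain ⟨x, hx⟩ := Set.Infinite.exists_accPt_principal h
  have hx := accPt_iff_frequently_nhdsNE.1 hx
  by_cases hxy : p x = y
  · obtain ⟨n, hn⟩ := hp.2 x
    exact hx (hn.eventually_ne.mono fun z hz hz' => hz (hz'.trans hxy.symm))
  · exact hx ((hp.1.continuousAt.eventually_ne hxy).filter_mono nhdsWithin_le_nhds)

/-- The infimum of the empty set is `0`, so the value `1` means that some exponent exists and that
the infimum is attained. -/
theorem hasLocalForm_one_of_ramificationIndex {p : X → Y} {x : X}
    (h : ramificationIndex p x = 1) : HasLocalForm p x 1 := by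
  have hne : {n : ℕ | HasLocalForm p x n}.Nonempty := by
    by_contra hemp
    rw [Set.not_nonempty_iff_eq_empty] at hemp
    rw [ramificationIndex, hemp, Nat.sInf_empty] at h
    exact zero_ne_one h
  have := Nat.sInf_mem hne
  rwa [show sInf {n : ℕ | HasLocalForm p x n} = 1 from h] at this

theorem HasLocalForm.exists_injOn {p : X → Y} {x : X} (h : HasLocalForm p x 1) :
    ∃ U ∈ 𝓝 x, Set.InjOn p U := by
  obtain ⟨-, φ, ψ, hx, -, -, -, hpow⟩ := h
  refine ⟨φ.source, φ.open_source.mem_nhds hx, fun y hy z hz hyz => φ.injOn hy hz ?_⟩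
  rw [← pow_one (φ y), ← pow_one (φ z), ← (hpow y hy).2, ← (hpow z hz).2, hyz]

/-! ### Invariance of the ramification under symmetries -/

theorem HasLocalForm.of_comm {p : X → Y} {f : X ≃ₜ X} {F : Y ≃ₜ Y} (h : ∀ x, p (f x) = F (p x))
    {x : X} {n : ℕ} (hx : HasLocalForm p (f x) n) : HasLocalForm p x n := by
  obtain ⟨hn, φ, ψ, h1, h2, h3, h4, h5⟩ := hx
  refine ⟨hn, f.toOpenPartialHomeomorph.trans φ, F.toOpenPartialHomeomorph.trans ψ, ?_, ?_, h3, ?_,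
    fun y hy => ?_⟩
  · simpa using h1
  · simpa [← h] using h2
  · simpa [← h] using h4
  · have hy' : f y ∈ φ.source := by simpa using hy
    have := h5 (f y) hy'
    simpa [← h] using this

theorem comm_symm {p : X → Y} {f : X ≃ₜ X} {F : Y ≃ₜ Y} (h : ∀ x, p (f x) = F (p x)) (x : X) :
    p (f.symm x) = F.symm (p x) := by
  rw [← F.symm_apply_apply (p (f.symm x)), ← h, f.apply_symm_apply]

/-- The whole sets of admissible exponents agree, so uniqueness of the exponent plays no role. -/
theorem ramificationIndex_comm {p : X → Y} {f : X ≃ₜ X} {F : Y ≃ₜ Y}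
    (h : ∀ x, p (f x) = F (p x)) (x : X) : ramificationIndex p (f x) = ramificationIndex p x := by
  have : {n : ℕ | HasLocalForm p (f x) n} = {n : ℕ | HasLocalForm p x n} := by
    ext n
    refine ⟨fun hn => HasLocalForm.of_comm h hn, fun hn => ?_⟩
    refine HasLocalForm.of_comm (f := f.symm) (comm_symm h) ?_
    rwa [f.symm_apply_apply]
  rw [ramificationIndex, this, ramificationIndex]

/-- `f` maps the fibre over `y` bijectively to the fibre over `F y` and preserves indices. It serves
both for affine maps of the torus and for the descended map of `M₃`. -/
theorem ramificationData_comm {p : X → Y} {f : X ≃ₜ X} {F : Y ≃ₜ Y}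
    (h : ∀ x, p (f x) = F (p x)) (y : Y) : ramificationData p (F y) = ramificationData p y := by
  funext n
  simp only [ramificationData]
  rw [← f.injective.encard_image {x | p x = y ∧ ramificationIndex p x = n}]
  congr 1
  ext x
  constructor
  · rintro ⟨h1, h2⟩
    refine ⟨f.symm x, ⟨?_, ?_⟩, f.apply_symm_apply x⟩
    · rw [comm_symm h, h1, F.symm_apply_apply]
    · rw [ramificationIndex_comm (comm_symm h), h2]
  · rintro ⟨z, ⟨h1, h2⟩, rfl⟩
    exact ⟨by rw [h, h1], by rw [ramificationIndex_comm h, h2]⟩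

end LocalForm

theorem image_zeros {X : Type*} [TopologicalSpace X] {q : X → Torus} {f : X ≃ₜ X}
    {F : Torus ≃ₜ Torus} (h : ∀ x, q (f x) = F (q x)) : f '' zeros q = zeros q := by
  ext x
  constructor
  · rintro ⟨z, hz, rfl⟩
    exact fun h' => hz ((ramificationIndex_comm h z).symm.trans h')
  · intro hx
    refine ⟨f.symm x, fun h' => hx ?_, f.apply_symm_apply x⟩
    rwa [ramificationIndex_comm (comm_symm h)] at h'

/-! ### Affine maps of translation surfaces over the torus -/

section Affine

variable {X : Type*} [TopologicalSpace X] {q : X → Torus}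

/-- With exponent `1` the map `q` is a local homeomorphism; composing it with a local inverse of
`toTorus` gives the chart. -/
theorem exists_translationChart {x : X} (hx : x ∉ zeros q) :
    ∃ χ : OpenPartialHomeomorph X (Fin 2 → ℝ), x ∈ χ.source ∧ IsTranslationChart q χ := by
  obtain ⟨-, φ, ψ, hxφ, hqx, -, -, hpow⟩ :=
    hasLocalForm_one_of_ramificationIndex (p := q) (x := x) (not_not.1 hx)
  obtain ⟨τ, hτ, hτv⟩ := exists_toTorus_chart (q x)
  have heq : ∀ y ∈ φ.source, ψ.symm (φ y) = q y := fun y hy => by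
    rw [← pow_one (φ y), ← (hpow y hy).2, ψ.left_inv (hpow y hy).1]
  refine ⟨(φ.trans ψ.symm).trans τ.symm, ?_, fun y hy => ?_⟩
  · simp only [OpenPartialHomeomorph.trans_source, Set.mem_inter_iff, Set.mem_preimage,
      OpenPartialHomeomorph.symm_source, OpenPartialHomeomorph.coe_trans, Function.comp_apply]
    refine ⟨⟨hxφ, ?_⟩, ?_⟩
    · rw [← pow_one (φ x), ← (hpow x hxφ).2]
      exact ψ.map_source hqx
    · rwa [heq x hxφ]
  · simp only [OpenPartialHomeomorph.trans_source, Set.mem_inter_iff, Set.mem_preimage,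
      OpenPartialHomeomorph.symm_source, OpenPartialHomeomorph.coe_trans, Function.comp_apply] at hy
    simp only [OpenPartialHomeomorph.coe_trans, Function.comp_apply]
    rw [← hτv, heq y hy.1.1, τ.right_inv]
    rw [← heq y hy.1.1]
    exact hy.2

/-- The function `ψ ∘ f - A φ` is continuous with values in a single fibre of `toTorus`, a coset of
the lattice, so it is locally constant. -/
theorem hasLinearPart_of_comm {f : X ≃ₜ X} {γ : Matrix (Fin 2) (Fin 2) ℤ} {c : Torus}
    (h : ∀ x, q (f x) = torusEnd γ (q x) + c) :
    HasLinearPart q f (γ.map (Int.cast : ℤ → ℝ)) := by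
  intro φ ψ hφ hψ x hx hfx
  set A : Matrix (Fin 2) (Fin 2) ℝ := γ.map (Int.cast : ℤ → ℝ)
  set D : X → Fin 2 → ℝ := fun y => ψ (f y) - A.mulVec (φ y) with hD
  have hsrc : ∀ᶠ y in 𝓝 x, y ∈ φ.source ∧ f y ∈ ψ.source :=
    (φ.open_source.eventually_mem hx).and
      (f.continuous.continuousAt.eventually (ψ.open_source.mem_nhds hfx))
  have hDc : ∀ y, y ∈ φ.source → f y ∈ ψ.source → toTorus (D y) = c := by
    intro y hy hfy
    rw [hD, toTorus_sub, hψ _ hfy, h, ← torusEnd_toTorus, hφ _ hy, add_sub_cancel_left]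
  have hcont : Tendsto (fun y => D y - D x) (𝓝 x) (𝓝 0) := by
    have h1 : ContinuousAt (fun y => ψ (f y)) x :=
      ContinuousAt.comp (f := f) (ψ.continuousAt hfx) f.continuous.continuousAt
    have h2 : ContinuousAt (fun y => A.mulVec (φ y)) x :=
      ContinuousAt.comp (g := fun v => A.mulVec v) (f := φ)
        (Continuous.matrix_mulVec continuous_const continuous_id).continuousAt (φ.continuousAt hx)
    have h3 : Tendsto (fun y => D y - D x) (𝓝 x) (𝓝 (D x - D x)) :=
      ((h1.sub h2).sub continuousAt_const).tendsto
    rwa [sub_self] at h3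
  refine ⟨D x, ?_⟩
  filter_upwards [hsrc, hcont.eventually eventually_smallLift_toTorus] with y hy hy'
  rw [toTorus_sub, hDc y hy.1 hy.2, hDc x hx hfx, sub_self, smallLift_zero] at hy'
  rw [← sub_eq_zero.1 hy'.symm, hD, add_sub_cancel]

/-- The affine automorphism of the torus with linear part `γ` and translation part `c`. -/
def torusAffine (γ : Matrix.SpecialLinearGroup (Fin 2) ℤ) (c : Torus) : Torus ≃ₜ Torus where
  toFun P := torusEnd γ.1 P + c
  invFun P := torusEnd (γ⁻¹).1 (P - c)
  left_inv P := by
    change torusEnd (γ⁻¹).1 (torusEnd γ.1 P + c - c) = P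
    rw [add_sub_cancel_right, ← torusEnd_mul, ← Matrix.SpecialLinearGroup.coe_mul, inv_mul_cancel,
      Matrix.SpecialLinearGroup.coe_one, torusEnd_one]
  right_inv P := by
    change torusEnd γ.1 (torusEnd (γ⁻¹).1 (P - c)) + c = P
    rw [← torusEnd_mul, ← Matrix.SpecialLinearGroup.coe_mul, mul_inv_cancel,
      Matrix.SpecialLinearGroup.coe_one, torusEnd_one, sub_add_cancel]
  continuous_toFun := (continuous_torusEnd _).add continuous_const
  continuous_invFun := (continuous_torusEnd _).comp (continuous_id.sub continuous_const)

theorem mem_aff_of_comm {f : X ≃ₜ X} {γ : Matrix.SpecialLinearGroup (Fin 2) ℤ} {c : Torus}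
    (h : ∀ x, q (f x) = torusEnd γ.1 (q x) + c) : f ∈ Aff q := by
  refine ⟨image_zeros (F := torusAffine γ c) h, fun φ ψ hφ hψ x hx hfx => ?_⟩
  obtain ⟨b, hb⟩ := hasLinearPart_of_comm h φ ψ hφ hψ x hx hfx
  refine ⟨_, b, ?_, hb⟩
  have : (γ.1.map (Int.cast : ℤ → ℝ)).det = 1 := by
    have := γ.2
    rw [Matrix.det_fin_two] at this ⊢
    simp only [Matrix.map_apply]
    exact_mod_cast this
  rw [this]
  exact one_pos

/-- The inverse of an affine homeomorphism is affine. -/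
theorem symm_mem_aff {f : X ≃ₜ X} (hf : f ∈ Aff q) : f.symm ∈ Aff q := by
  refine ⟨?_, fun φ ψ hφ hψ x hx hfx => ?_⟩
  · conv_lhs => rw [← hf.1]
    rw [← Set.image_comp]
    simp
  · obtain ⟨A, b, hA, h⟩ := hf.2 ψ φ hψ hφ (f.symm x) hfx (by simpa using hx)
    have hu : IsUnit A.det := hA.ne'.isUnit
    refine ⟨A⁻¹, -A⁻¹.mulVec b, ?_, ?_⟩
    · rw [Matrix.det_nonsing_inv, Ring.inverse_eq_inv']
      exact inv_pos.2 hA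
    · filter_upwards [f.symm.continuous.continuousAt.eventually h] with y hy
      rw [f.apply_symm_apply] at hy
      rw [hy, Matrix.mulVec_add, Matrix.mulVec_mulVec, Matrix.nonsing_inv_mul _ hu,
        Matrix.one_mulVec, add_neg_cancel_right]

/-- Near `x`, the map `q ∘ f` is the composition of `q` with an affine map with linear
part `A`. -/
def IsAffineAt (q : X → Torus) (f : X ≃ₜ X) (A : Matrix (Fin 2) (Fin 2) ℝ) (x : X) : Prop :=
  ∀ᶠ y in 𝓝 x, q (f y) - q (f x) = toTorus (A.mulVec (smallLift (q y - q x)))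

theorem tendsto_sub_self (hq : Continuous q) (x : X) :
    Tendsto (fun y => q y - q x) (𝓝 x) (𝓝 0) := by
  have := (hq.sub continuous_const).tendsto (x := x) (f := fun y => q y - q x)
  simpa using this

theorem exists_isAffineAt {f : X ≃ₜ X} (hf : f ∈ Aff q) {x : X}
    (hx : x ∉ zeros q) : ∃ A : Matrix (Fin 2) (Fin 2) ℝ, 0 < A.det ∧ IsAffineAt q f A x := by
  have hfx : f x ∉ zeros q := by
    rw [← hf.1]
    rintro ⟨z, hz, h⟩
    exact hx (f.injective h ▸ hz)
  obtain ⟨φ, hxφ, hφ⟩ := exists_translationChart hx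
  obtain ⟨ψ, hxψ, hψ⟩ := exists_translationChart hfx
  obtain ⟨A, b, hA, h⟩ := hf.2 φ ψ hφ hψ x hxφ hxψ
  refine ⟨A, hA, ?_⟩
  have hc : Tendsto (fun y => φ y - φ x) (𝓝 x) (𝓝 0) := by
    have : Tendsto (fun y => φ y - φ x) (𝓝 x) (𝓝 (φ x - φ x)) :=
      ((φ.continuousAt hxφ).sub continuousAt_const).tendsto
    rwa [sub_self] at this
  filter_upwards [h, hc.eventually eventually_smallLift_toTorus, φ.open_source.mem_nhds hxφ,
    f.continuous.continuousAt.eventually (ψ.open_source.mem_nhds hxψ)] with y h1 h2 h3 h4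
  rw [← hψ _ h4, ← hψ _ hxψ, ← hφ _ h3, ← hφ _ hxφ, ← toTorus_sub, ← toTorus_sub, h2, h1,
    h.self_of_nhds, Matrix.mulVec_sub, add_sub_add_right_eq_sub]

/-- Subtracting the relations for two points near `x` moves the base point, because small lifts
subtract correctly. -/
theorem eventually_isAffineAt (hq : Continuous q) {f : X ≃ₜ X} {A : Matrix (Fin 2) (Fin 2) ℝ}
    {x : X} (h : IsAffineAt q f A x) : ∀ᶠ y in 𝓝 x, IsAffineAt q f A y := by
  have h' := h.and ((tendsto_sub_self hq x).eventually eventually_isSmall)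
  filter_upwards [eventually_eventually_nhds.2 h'] with y hy
  filter_upwards [hy] with z hz
  have hy0 := hy.self_of_nhds
  rw [← sub_sub_sub_cancel_right (q (f z)) (q (f y)) (q (f x)), hz.1, hy0.1,
    ← sub_sub_sub_cancel_right (q z) (q y) (q x), smallLift_sub hz.2 hy0.2, Matrix.mulVec_sub,
    toTorus_sub]

/-- As `q` is open, `q y` fills a neighbourhood of `q x`, so the two linear maps have the same germ
on the torus. -/
theorem isAffineAt_unique (hqo : IsOpenMap q) {f : X ≃ₜ X}
    {A B : Matrix (Fin 2) (Fin 2) ℝ} {x : X} (hA : IsAffineAt q f A x) (hB : IsAffineAt q f B x) :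
    A = B := by
  refine eq_of_eventually_toTorus_mulVec_eq ?_
  have h : ∀ᶠ P in 𝓝 (q x), toTorus (A.mulVec (smallLift (P - q x))) =
      toTorus (B.mulVec (smallLift (P - q x))) := by
    refine hqo.nhds_le x (eventually_map.2 ?_)
    filter_upwards [hA, hB] with y h1 h2
    rw [← h1, ← h2]
  have hc : Tendsto (fun v => q x + toTorus v) (𝓝 0) (𝓝 (q x)) := by
    have := (continuous_const.add continuous_toTorus).tendsto (x := 0)
      (f := fun v => q x + toTorus v)
    simpa [toTorus_zero] using this
  filter_upwards [hc.eventually h, eventually_smallLift_toTorus] with v hv hv'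
  rwa [add_sub_cancel_left, hv'] at hv

/-- The linear part of an affine homeomorphism is globally constant, also at the zeros. -/
theorem exists_forall_isAffineAt [T2Space X] [PreconnectedSpace X] [Nonempty X]
    (hX : IsPuncturedConnected X) (hq : Continuous q) (hqo : IsOpenMap q)
    (hz : (zeros q).Finite) {f : X ≃ₜ X} (hf : f ∈ Aff q) :
    ∃ A : Matrix (Fin 2) (Fin 2) ℝ, 0 < A.det ∧ ∀ x, IsAffineAt q f A x := by
  have hex := hz.eventually_nhdsNE_notMem
  obtain ⟨x₀⟩ := ‹Nonempty X›
  have := (hX x₀).1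
  obtain ⟨x₁, hx₁⟩ := (hex x₀).exists
  obtain ⟨A, hA, hA₁⟩ := exists_isAffineAt hf hx₁
  refine ⟨A, hA, ?_⟩
  have hoff : ∀ x ∉ zeros q, IsAffineAt q f A x := by
    refine (hX.forall_or_forall hz (P := IsAffineAt q f A) fun x hx => ?_).resolve_right
      fun h => h x₁ hx₁ hA₁
    obtain ⟨B, -, hB⟩ := exists_isAffineAt hf hx
    by_cases hAB : A = B
    · exact Or.inl (eventually_isAffineAt hq (hAB ▸ hB))
    · exact Or.inr ((eventually_isAffineAt hq hB).mono fun y hy hy' =>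
        hAB (isAffineAt_unique hqo hy' hy))
  intro x
  have hV : ∀ᶠ y in 𝓝 x, IsSmall (q y - q x) ∧ (y ≠ x → y ∉ zeros q) :=
    ((tendsto_sub_self hq x).eventually eventually_isSmall).and
      (eventually_nhdsWithin_iff.1 (hex x))
  obtain ⟨V, hVsub, hVo, hxV⟩ := mem_nhds_iff.1 hV
  obtain ⟨U, hU, hUV, hUc⟩ := (hX x).2 V (hVo.mem_nhds hxV)
  -- This is the translation part. It is locally constant on a connected punctured neighbourhood,
  -- hence constant there, and its limit at `x` is `q (f x)`.
  set val : X → Torus := fun y => q (f y) - toTorus (A.mulVec (smallLift (q y - q x))) with hval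
  have hloc : ∀ y ∈ U \ {x}, ∀ᶠ z in 𝓝 y, val z = val y := by
    intro y hy
    have hyV := hVsub (hUV hy.1)
    filter_upwards [hoff y (hyV.2 hy.2), hVo.mem_nhds (hUV hy.1)] with z hz hzV
    have hzV := hVsub hzV
    rw [← sub_sub_sub_cancel_right (q z) (q y) (q x), smallLift_sub hzV.1 hyV.1,
      Matrix.mulVec_sub, toTorus_sub] at hz
    simp only [hval]
    rw [sub_eq_sub_iff_sub_eq_sub, hz]
  have hconst : ∀ y ∈ U \ {x}, ∀ z ∈ U \ {x}, val z = val y := by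
    intro y hy z hz
    have := hUc.subset_or_subset (u := {z | ∀ᶠ w in 𝓝 z, val w = val y})
      (v := {z | ∀ᶠ w in 𝓝 z, val w ≠ val y})
      isOpen_setOfPred_eventually_nhds isOpen_setOfPred_eventually_nhds
      (Set.disjoint_left.2 fun w (h : ∀ᶠ z in 𝓝 w, val z = val y)
        (h' : ∀ᶠ z in 𝓝 w, val z ≠ val y) => h'.self_of_nhds h.self_of_nhds)
      (fun w hw => by
        by_cases h : val w = val y
        · exact Or.inl ((hloc w hw).mono fun z hz => hz.trans h)
        · exact Or.inr ((hloc w hw).mono fun z hz h' => h (hz.symm.trans h')))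
    rcases this with h | h
    · exact (h hz : ∀ᶠ w in 𝓝 z, val w = val y).self_of_nhds
    · exact absurd rfl (h hy : ∀ᶠ w in 𝓝 y, val w ≠ val y).self_of_nhds
  have hlim : Tendsto val (𝓝 x) (𝓝 (q (f x))) := by
    have h1 : Tendsto (fun y => q (f y)) (𝓝 x) (𝓝 (q (f x))) :=
      (hq.comp f.continuous).continuousAt
    have h2 : Tendsto (fun y => toTorus (A.mulVec (smallLift (q y - q x)))) (𝓝 x) (𝓝 0) := by
      have := ((continuous_toTorus_mulVec A).tendsto 0).comp
        ((tendsto_smallLift_sub (q x)).comp hq.continuousAt)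
      rwa [Matrix.mulVec_zero, toTorus_zero] at this
    have h3 := h1.sub h2
    rwa [sub_zero] at h3
  have hU' : U \ {x} ∈ 𝓝[≠] x := inter_mem (nhdsWithin_le_nhds hU) self_mem_nhdsWithin
  have hval_eq : ∀ y ∈ U \ {x}, val y = q (f x) := by
    intro y hy
    have := (hX x).1
    refine tendsto_nhds_unique_of_eventuallyEq tendsto_const_nhds
      (hlim.mono_left nhdsWithin_le_nhds) (l := 𝓝[≠] x) ?_
    filter_upwards [hU'] with z hz
    exact hconst z hz y hy
  filter_upwards [hU] with y hy
  rcases eq_or_ne y x with rfl | hne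
  · rw [sub_self, sub_self, smallLift_zero, Matrix.mulVec_zero, toTorus_zero]
  · rw [← hval_eq y ⟨hy, hne⟩, hval, sub_sub_cancel]

/-- The graph of the affine map with linear part `A` through one point of `X`
extends over the whole plane. -/
theorem exists_point_over [CompactSpace X] (hq : Continuous q) (hqo : IsOpenMap q) {f : X ≃ₜ X}
    {A : Matrix (Fin 2) (Fin 2) ℝ} (hA : ∀ x, IsAffineAt q f A x) {z : X} {v : Fin 2 → ℝ}
    (hz : q z = toTorus v) (w : Fin 2 → ℝ) :
    ∃ y, q y = toTorus w ∧ q (f y) - q (f z) = toTorus (A.mulVec (w - v)) := by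
  set C : Set (Fin 2 → ℝ) :=
    {w | ∃ y, q y = toTorus w ∧ q (f y) - q (f z) = toTorus (A.mulVec (w - v))} with hC
  -- Closedness rests on compactness of `X`, openness below on openness of `q` and the local affine
  -- relation.
  have hclosed : IsClosed C := by
    have h : IsClosed {s : (Fin 2 → ℝ) × X | q s.2 = toTorus s.1 ∧
        q (f s.2) - q (f z) = toTorus (A.mulVec (s.1 - v))} := by
      refine (isClosed_eq (hq.comp continuous_snd)
        (continuous_toTorus.comp continuous_fst)).inter (isClosed_eq ?_ ?_)
      · exact (hq.comp (f.continuous.comp continuous_snd)).sub continuous_const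
      · exact (continuous_toTorus_mulVec A).comp (continuous_fst.sub continuous_const)
    convert isClosedMap_fst_of_compactSpace _ h using 1
    ext w
    simp [hC]
  have hopen : IsOpen C := by
    refine isOpen_iff_mem_nhds.2 ?_
    rintro w ⟨y, hy, hy'⟩
    have h1 : ∀ᶠ P in 𝓝 (q y), ∃ y', q y' = P ∧
        q (f y') - q (f y) = toTorus (A.mulVec (smallLift (P - q y))) := by
      refine hqo.nhds_le y (eventually_map.2 ?_)
      filter_upwards [hA y] with y' hy'
      exact ⟨y', rfl, hy'⟩
    have hc : Tendsto toTorus (𝓝 w) (𝓝 (q y)) := hy ▸ continuous_toTorus.continuousAt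
    have hd : Tendsto (fun w' : Fin 2 → ℝ => w' - w) (𝓝 w) (𝓝 0) := by
      have := (continuous_id.sub continuous_const).tendsto (x := w)
        (f := fun w' : Fin 2 → ℝ => w' - w)
      simpa using this
    filter_upwards [hc.eventually h1, hd.eventually eventually_smallLift_toTorus]
      with w' ⟨y', h2, h3⟩ h4
    refine ⟨y', h2, ?_⟩
    rw [hy, ← toTorus_sub, h4] at h3
    rw [← sub_add_sub_cancel (q (f y')) (q (f y)), h3, hy', ← toTorus_add, ← Matrix.mulVec_add,
      sub_add_sub_cancel]
  have huniv : C = Set.univ :=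
    IsClopen.eq_univ ⟨hclosed, hopen⟩ ⟨v, z, hz, by
      rw [sub_self, sub_self, Matrix.mulVec_zero, toTorus_zero]⟩
  have : w ∈ C := huniv ▸ Set.mem_univ w
  exact this

/-- Affine homeomorphisms with integral linear part descend to the torus. -/
theorem exists_comm_of_isAffineAt [PreconnectedSpace X] [Nonempty X]
    {f : X ≃ₜ X} {γ : Matrix (Fin 2) (Fin 2) ℤ}
    (hA : ∀ x, IsAffineAt q f (γ.map (Int.cast : ℤ → ℝ)) x) :
    ∃ c, ∀ x, q (f x) = torusEnd γ (q x) + c := by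
  obtain ⟨x₀⟩ := ‹Nonempty X›
  -- An integral matrix acts on the torus itself, so the small lift disappears from the local
  -- relation.
  have hloc : IsLocallyConstant fun x => q (f x) - torusEnd γ (q x) := by
    refine (IsLocallyConstant.iff_eventually_eq _).2 fun x => ?_
    filter_upwards [hA x] with y hy
    rw [← torusEnd_toTorus, toTorus_smallLift, torusEnd_sub] at hy
    rw [sub_eq_sub_iff_sub_eq_sub, hy]
  refine ⟨q (f x₀) - torusEnd γ (q x₀), fun x => ?_⟩
  rw [← hloc.apply_eq_of_preconnectedSpace x x₀, add_sub_cancel]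

end Affine

/-! ### Coverings of `M₃` -/

/-- Two lifts to `M₃` of the same map to the torus differ by a deck transformation. -/
theorem exists_deck_comp_eq {X : Type*} [TopologicalSpace X] [T2Space X] [PreconnectedSpace X]
    [Nonempty X] (hX : IsPuncturedConnected X) {u v : X → EW} (hu : Continuous u)
    (hv : Continuous v) (huv : ∀ x, ewProj (v x) = ewProj (u x))
    (hfin : {x | ewProj (v x) = 0}.Finite) : ∃ k, ∀ x, deck k (v x) = u x := by
  have hex := hfin.eventually_nhdsNE_notMem
  obtain ⟨x₀⟩ := ‹Nonempty X›
  have := (hX x₀).1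
  obtain ⟨x₁, hx₁⟩ := (hex x₀).exists
  obtain ⟨k, hk⟩ := exists_deck_eq (huv x₁)
  refine ⟨k, ?_⟩
  have hcont : ∀ k, Continuous fun x => deck k (v x) := fun k => (deck k).continuous.comp hv
  have hoff : ∀ x ∉ {x | ewProj (v x) = 0}, deck k (v x) = u x := by
    refine (hX.forall_or_forall hfin (P := fun x => deck k (v x) = u x)
      fun x hx => ?_).resolve_right fun h => h x₁ hx₁ hk
    -- Away from the vertices only `k'` works at `x`. The other finitely many deck transformations
    -- fail on a neighbourhood, so `k'` is the only one that works there.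
    obtain ⟨k', hk'⟩ := exists_deck_eq (huv x)
    have hne : ∀ᶠ y in 𝓝 x, ∀ l, l ≠ k' → deck l (v y) ≠ u y := by
      refine eventually_all.2 fun l => ?_
      by_cases hl : l = k'
      · exact Eventually.of_forall fun y h => absurd hl h
      · have h : deck l (v x) ≠ u x := fun h => hl (deck_injective hx (h.trans hk'.symm))
        exact (((hcont l).continuousAt.ne_iff_eventually_ne hu.continuousAt).1 h).mono
          fun y hy _ => hy
    by_cases hkk : k = k'
    · refine Or.inl (hne.mono fun y hy => ?_)
      obtain ⟨l, hl⟩ := exists_deck_eq (huv y)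
      have : l = k' := by
        by_contra h
        exact hy l h hl
      rwa [hkk, ← this]
    · exact Or.inr (hne.mono fun y hy => hy k hkk)
  intro x
  have hclosed : IsClosed {x | deck k (v x) = u x} := isClosed_eq (hcont k) hu
  have := (hX x).1
  exact hclosed.mem_of_tendsto (tendsto_id.mono_left nhdsWithin_le_nhds : Tendsto id (𝓝[≠] x) _)
    ((hex x).mono fun y hy => hoff y hy)

section Covering

variable {X : Type*} [TopologicalSpace X] {p : X → EW}

theorem continuous_ewProj_comp (hp : IsRamifiedCovering p) : Continuous (ewProj ∘ p) :=
  continuous_ewProj.comp hp.1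

theorem isOpenMap_ewProj_comp (hp : IsRamifiedCovering p) : IsOpenMap (ewProj ∘ p) :=
  isOpenMap_ewProj.comp hp.isOpenMap

theorem finite_ewProj_comp_fibre [CompactSpace X] (hp : IsRamifiedCovering p) (P : Torus) :
    ((ewProj ∘ p) ⁻¹' {P}).Finite := by
  rw [Set.preimage_comp]
  exact (finite_ewProj_fibre P).preimage' fun y _ => hp.finite_fibre y

theorem finite_zeros [CompactSpace X] (hp : IsRamifiedCovering p)
    (hA : ConditionA (ewProj ∘ p)) : (zeros (ewProj ∘ p)).Finite := by
  refine (finite_fourDivisionPoints.preimage' (f := ewProj ∘ p)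
    fun P _ => finite_ewProj_comp_fibre hp P).subset fun x hx => ?_
  exact hA _ ⟨x, rfl, hx⟩

/-- All points over the origin are zeros. -/
theorem mem_zeros_of_eq_zero (hp : IsRamifiedCovering p) {x : X} (hx : ewProj (p x) = 0) :
    x ∈ zeros (ewProj ∘ p) := by
  intro h
  -- If `q` were injective on `U`, then `ewProj` would be injective on `p '' U`, a neighbourhood of
  -- `p x`.
  obtain ⟨U, hU, hinj⟩ := (hasLocalForm_one_of_ramificationIndex h).exists_injOn
  refine not_injOn_ewProj hx (hp.isOpenMap.image_mem_nhds hU) ?_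
  rintro _ ⟨y, hy, rfl⟩ _ ⟨z, hz, rfl⟩ h
  rw [hinj hy hz h]

theorem IsRamifiedCovering.surjective [CompactSpace X] [Nonempty X] (hp : IsRamifiedCovering p) :
    Function.Surjective p := by
  rw [← Set.range_eq_univ]
  exact IsClopen.eq_univ ⟨(isCompact_range hp.1).isClosed, hp.isOpenMap.isOpen_range⟩
    (Set.range_nonempty p)

theorem ewProj_comp_surjective [CompactSpace X] [Nonempty X] (hp : IsRamifiedCovering p) :
    Function.Surjective (ewProj ∘ p) := by
  rw [← Set.range_eq_univ]
  exact IsClopen.eq_univ ⟨(isCompact_range (continuous_ewProj_comp hp)).isClosed,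
    (isOpenMap_ewProj_comp hp).isOpen_range⟩ (Set.range_nonempty _)

variable [T2Space X] [CompactSpace X] [ConnectedSpace X]

/-- The linear part of an affine homeomorphism is integral. -/
theorem exists_int_isAffineAt (hp : IsRamifiedCovering p) (hA : ConditionA (ewProj ∘ p))
    (hB : ConditionB (ewProj ∘ p)) {f : X ≃ₜ X} (hf : f ∈ Aff (ewProj ∘ p)) :
    ∃ γ : Matrix (Fin 2) (Fin 2) ℤ, 0 < γ.det ∧
      ∀ x, IsAffineAt (ewProj ∘ p) f (γ.map (Int.cast : ℤ → ℝ)) x := by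
  have hq := continuous_ewProj_comp hp
  have hqo := isOpenMap_ewProj_comp hp
  obtain ⟨A, hdet, haff⟩ :=
    exists_forall_isAffineAt hp.isPuncturedConnected hq hqo (finite_zeros hp hA) hf
  -- `z` is a zero over the marked point and `y` a point over the origin, hence also a zero. Both
  -- images under `f` are zeros, so they lie over 4-division points.
  have hint : ∀ v ∈ ({![3 / 4, 0], ![0, 1 / 4]} : Set (Fin 2 → ℝ)), ∀ w, toTorus w = 0 →
      ∀ i, ∃ n : ℤ, 4 * A.mulVec (w - v) i = n := by
    intro v hv w hw
    have hmem : toTorus v ∈ markedPoints := by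
      rcases hv with rfl | rfl
      · exact Or.inr (Or.inl rfl)
      · exact Or.inr (Or.inr rfl)
    obtain ⟨z, hz, hzr⟩ := (hB _ hmem).1
    obtain ⟨y, hy, hyz⟩ := exists_point_over hq hqo haff hz w
    have hfour : ∀ x ∈ zeros (ewProj ∘ p), 4 • (ewProj ∘ p) (f x) = 0 := fun x hx =>
      hA _ ⟨f x, rfl, by
        have := Set.mem_image_of_mem f hx
        rw [hf.1] at this
        exact this⟩
    have h1 := hfour z hzr
    have h2 := hfour y (mem_zeros_of_eq_zero hp (hy.trans hw))
    have h3 : toTorus ((4 : ℕ) • A.mulVec (w - v)) = 0 := by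
      have e : toTorus ((4 : ℕ) • A.mulVec (w - v)) = 4 • toTorus (A.mulVec (w - v)) := rfl
      rw [e, ← hyz, smul_sub, h1, h2, sub_zero]
    intro i
    obtain ⟨n, hn⟩ := toTorus_eq_zero_iff.1 h3 i
    refine ⟨n, ?_⟩
    rw [← hn]
    simp
  -- The displacement from `(3/4, 0)` to `(1, 0)` is a quarter of the first basis vector.
  have h0 : ∀ i, ∃ n : ℤ, A i 0 = n := fun i => by
    obtain ⟨n, hn⟩ := hint ![3 / 4, 0] (Or.inl rfl) ![1, 0]
      (toTorus_eq_zero_iff.2 fun i => by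
        fin_cases i
        · exact ⟨1, by simp⟩
        · exact ⟨0, by simp⟩) i
    refine ⟨n, ?_⟩
    simp [Matrix.mulVec, dotProduct, Fin.sum_univ_two] at hn
    linarith
  -- The displacement from `(0, 1/4)` to the origin is minus a quarter of the second basis vector,
  -- hence the sign of the witness.
  have h1 : ∀ i, ∃ n : ℤ, A i 1 = n := fun i => by
    obtain ⟨n, hn⟩ := hint ![0, 1 / 4] (Or.inr rfl) 0 toTorus_zero i
    refine ⟨-n, ?_⟩
    simp [Matrix.mulVec, dotProduct, Fin.sum_univ_two] at hn
    push_cast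
    linarith
  choose a ha using h0
  choose b hb using h1
  have hA' : (Matrix.of fun i => ![a i, b i]).map (Int.cast : ℤ → ℝ) = A := by
    ext i j
    fin_cases j
    · simp [ha]
    · simp [hb]
  refine ⟨Matrix.of fun i => ![a i, b i], ?_, by rwa [hA']⟩
  rw [← hA', Matrix.det_fin_two] at hdet
  rw [Matrix.det_fin_two]
  simp only [Matrix.map_apply] at hdet
  exact_mod_cast hdet

/-- Affine homeomorphisms descend to affine automorphisms of the torus. -/
theorem exists_comm_of_mem_aff (hp : IsRamifiedCovering p) (hA : ConditionA (ewProj ∘ p))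
    (hB : ConditionB (ewProj ∘ p)) {f : X ≃ₜ X} (hf : f ∈ Aff (ewProj ∘ p)) :
    ∃ (γ : Matrix.SpecialLinearGroup (Fin 2) ℤ) (c : Torus),
      ∀ x, (ewProj ∘ p) (f x) = torusEnd γ.1 ((ewProj ∘ p) x) + c := by
  obtain ⟨γ, hγ, hγ'⟩ := exists_int_isAffineAt hp hA hB hf
  obtain ⟨δ, hδ, hδ'⟩ := exists_int_isAffineAt hp hA hB (symm_mem_aff hf)
  obtain ⟨c, hc⟩ := exists_comm_of_isAffineAt hγ'
  obtain ⟨d, hd⟩ := exists_comm_of_isAffineAt hδ'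
  -- The torus maps below `f` and `f.symm` compose to the identity, since `q` is surjective.
  have h1 : ∀ P, torusEnd (γ * δ) P + (torusEnd γ d + c) = P := by
    intro P
    obtain ⟨x, rfl⟩ := ewProj_comp_surjective hp P
    have := hc (f.symm x)
    rw [f.apply_symm_apply, hd, torusEnd_add, ← torusEnd_mul] at this
    rw [← add_assoc, ← this]
  have h2 : torusEnd γ d + c = 0 := by simpa [torusEnd_zero] using h1 0
  simp only [h2, add_zero] at h1
  have h3 : (γ * δ).map (Int.cast : ℤ → ℝ) =
      (1 : Matrix (Fin 2) (Fin 2) ℤ).map (Int.cast : ℤ → ℝ) := by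
    refine eq_of_eventually_toTorus_mulVec_eq (Eventually.of_forall fun v => ?_)
    rw [← torusEnd_toTorus, ← torusEnd_toTorus, h1, torusEnd_one]
  have h4 : γ * δ = 1 := Matrix.map_injective Int.cast_injective h3
  have h5 : γ.det * δ.det = 1 := by rw [← Matrix.det_mul, h4, Matrix.det_one]
  have h6 : γ.det = 1 := by
    rcases Int.eq_one_or_neg_one_of_mul_eq_one h5 with h | h <;> omega
  exact ⟨⟨γ, h6⟩, c, hc⟩

/-- The numerators `1` and `3` of the marked coordinates are units modulo `4` and can be cancelled.
-/
theorem intCast_zmod_four_eq {m k n : ℤ} {u : ℕ} (hu : u = 1 ∨ u = 3)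
    (h : ((m * u : ℤ) : ℝ) / 4 - ((k * u : ℤ) : ℝ) / 4 = n) : (m : ZMod 4) = k := by
  have h' : m * u - k * u = n * 4 := by
    have : ((m * u - k * u : ℤ) : ℝ) = ((n * 4 : ℤ) : ℝ) := by
      push_cast at h ⊢
      linarith
    exact_mod_cast this
  rw [ZMod.intCast_eq_intCast_iff_dvd_sub]
  push_cast
  rcases hu with rfl | rfl <;> push_cast at h' <;> omega

/-- Each fixed point determines one column of `γ` modulo `4`. -/
theorem mem_Gamma_four {γ : Matrix.SpecialLinearGroup (Fin 2) ℤ}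
    (h1 : torusEnd γ.1 (toTorus ![3 / 4, 0]) = toTorus ![3 / 4, 0])
    (h2 : torusEnd γ.1 (toTorus ![0, 1 / 4]) = toTorus ![0, 1 / 4]) :
    γ ∈ CongruenceSubgroup.Gamma 4 := by
  rw [torusEnd_toTorus, toTorus_eq_iff] at h1 h2
  simp only [Matrix.mulVec, dotProduct, Fin.sum_univ_two, Matrix.map_apply, Fin.forall_fin_two,
    Matrix.cons_val_zero, Matrix.cons_val_one, mul_zero, add_zero, zero_add, sub_zero] at h1 h2
  obtain ⟨⟨a, ha⟩, b, hb⟩ := h1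
  obtain ⟨⟨c, hc⟩, d, hd⟩ := h2
  rw [CongruenceSubgroup.Gamma_mem]
  refine ⟨?_, ?_, ?_, ?_⟩
  · exact_mod_cast intCast_zmod_four_eq (k := 1) (n := a) (Or.inr rfl) (by
      rw [← ha]; push_cast; ring_nf)
  · exact_mod_cast intCast_zmod_four_eq (k := 0) (n := c) (Or.inl rfl) (by
      rw [← hc]; push_cast; ring_nf)
  · exact_mod_cast intCast_zmod_four_eq (k := 0) (n := b) (Or.inr rfl) (by
      rw [← hb]; push_cast; ring_nf)
  · exact_mod_cast intCast_zmod_four_eq (k := 1) (n := d) (Or.inl rfl) (by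
      rw [← hd]; push_cast; ring_nf)

/-- Affine homeomorphisms descend to linear automorphisms of the torus in `Γ(4)`. -/
theorem exists_mem_Gamma_four_comm (hp : IsRamifiedCovering p) (hA : ConditionA (ewProj ∘ p))
    (hB : ConditionB (ewProj ∘ p)) {f : X ≃ₜ X} (hf : f ∈ Aff (ewProj ∘ p)) :
    ∃ γ ∈ CongruenceSubgroup.Gamma 4,
      ∀ x, (ewProj ∘ p) (f x) = torusEnd γ.1 ((ewProj ∘ p) x) := by
  obtain ⟨γ, c, h⟩ := exists_comm_of_mem_aff hp hA hB hf
  have hfix : ∀ P ∈ markedPoints, torusEnd γ.1 P + c = P := by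
    intro P hP
    by_contra hne
    exact (hB P hP).2 _ hne (ramificationData_comm (F := torusAffine γ c) h P)
  have hc : c = 0 := by
    have := hfix (toTorus ![0, 0]) (Or.inl rfl)
    have h0 : toTorus ![0, 0] = 0 := by
      rw [← toTorus_zero]; congr 1; ext i; fin_cases i <;> rfl
    rwa [h0, torusEnd_zero, zero_add] at this
  subst hc
  simp only [add_zero] at h hfix
  exact ⟨γ, mem_Gamma_four (hfix _ (Or.inr (Or.inl rfl))) (hfix _ (Or.inr (Or.inr rfl))), h⟩

/-- Affine homeomorphisms descend to `M₃`. -/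
theorem exists_descent (hp : IsRamifiedCovering p) (hA : ConditionA (ewProj ∘ p))
    (hB : ConditionB (ewProj ∘ p)) {f : X ≃ₜ X} (hf : f ∈ Aff (ewProj ∘ p)) :
    ∃ g ∈ Aff ewProj, g ∘ p = p ∘ f ∧ ∃ γ ∈ CongruenceSubgroup.Gamma 4,
      HasLinearPart (ewProj ∘ p) f (γ.1.map (Int.cast : ℤ → ℝ)) ∧
      HasLinearPart ewProj g (γ.1.map (Int.cast : ℤ → ℝ)) := by
  obtain ⟨γ, hγ, h⟩ := exists_mem_Gamma_four_comm hp hA hB hf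
  obtain ⟨g₀, hg₀⟩ := exists_isLiftOf γ
  -- `γ` is injective on the torus, so `g₀ ∘ p` meets the vertices only over the origin.
  have hfin : {x | ewProj (g₀ (p x)) = 0}.Finite := by
    refine (finite_ewProj_comp_fibre hp 0).subset fun x hx => ?_
    have hx : ewProj (g₀ (p x)) = 0 := hx
    rw [hg₀] at hx
    refine (torusAffine γ 0).injective ?_
    change torusEnd γ.1 (ewProj (p x)) + 0 = torusEnd γ.1 0 + 0
    rw [hx, torusEnd_zero]
  obtain ⟨k, hk⟩ := exists_deck_comp_eq hp.isPuncturedConnected (u := p ∘ f) (v := g₀ ∘ p)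
    (hp.1.comp f.continuous) (g₀.continuous.comp hp.1) (fun x => (hg₀ _).trans (h x).symm) hfin
  have hg : ∀ y, ewProj ((g₀.trans (deck k)) y) = torusEnd γ.1 (ewProj y) + 0 := fun y => by
    rw [add_zero, ← hg₀]
    exact ewProj_deck k (g₀ y)
  exact ⟨g₀.trans (deck k), mem_aff_of_comm hg, funext hk, γ, hγ,
    hasLinearPart_of_comm fun x => (h x).trans (add_zero _).symm, hasLinearPart_of_comm hg⟩

end Covering

theorem propositionp2 {X : Type*} [TopologicalSpace X] [T2Space X] [CompactSpace X]
    [ConnectedSpace X] (p : X → EW) (hp : IsRamifiedCovering p)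
    (hA : ConditionA (ewProj ∘ p)) (hB : ConditionB (ewProj ∘ p)) :
    (∀ f ∈ Aff (ewProj ∘ p), ∃ g ∈ Aff ewProj, g ∘ p = p ∘ f ∧
      ∃ γ ∈ CongruenceSubgroup.Gamma 4,
        HasLinearPart (ewProj ∘ p) f (γ.1.map (Int.cast : ℤ → ℝ)) ∧
        HasLinearPart ewProj g (γ.1.map (Int.cast : ℤ → ℝ))) ∧
    (ConditionC p → ∀ f ∈ Aff (ewProj ∘ p), ∀ g ∈ Aff ewProj, g ∘ p = p ∘ f →
      g ∈ AffFixingZeros ∧ g ∈ GammaEW4) := by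
  refine ⟨fun f hf => exists_descent hp hA hB hf, fun hC f hf g hg hgf => ?_⟩
  have hfix : g ∈ AffFixingZeros := by
    refine ⟨hg, fun z hz => ?_⟩
    by_contra hne
    have hgz : g z ∈ zeros ewProj := hg.1 ▸ Set.mem_image_of_mem g hz
    exact hC _ hgz _ hz hne (ramificationData_comm (fun x => (congrFun hgf x).symm) z)
  -- Since `p` is surjective, `f` has only one descent, so the given `g` inherits the linear part of
  -- the constructed one.
  obtain ⟨g', -, hg', γ, hγ, -, hlin⟩ := exists_descent hp hA hB hf
  have : g' = g := by
    ext y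
    obtain ⟨x, rfl⟩ := hp.surjective y
    exact congrFun (hg'.trans hgf.symm) x
  exact ⟨hfix, hfix, γ, hγ, this ▸ hlin⟩
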